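/- **Setting.** Let $M,N\ge 1$, expiries $0=T_0<T_1<\dots<T_M$, strikes $0=K^0<K^1<\dots<K^N$, and market mid and ask call prices $C_j^i$, $A_j^i$ ($1\le j\le M$, $0\le i\le N$; expiry $T_j$, strike $K^i$) with $C_j^i<A_j^i$ for all $i,j$. Put $dC_j^i=\frac{C_j^{i+1}-C_j^i}{K^{i+1}-K^i}$ for $i<N$ and $dC_j^N=0$. Assume that the mid prices are arbitrage-free: for all $j$, $C_j^0=1$, $dC_j^0=-1$, $C_j^N=0$, $dC_j^i\le dC_j^{i+1}$ for $0\le i<N$, and $C_j^i\le C_{j+1}^i$ for $0\le i\le N$ (if $j<M$). **Definitions.** For $s>0$, $k\ge0$, $v\geq 0$ let $\mathrm{Call}(s,k,v)=s\,\mathcal N(d_+)-k\,\mathcal N(d_-)$, $d_\pm=\frac{-\ln(k/s)\pm v/2}{\sqrt v}$, be the Black–Scholes call price, with $\mathrm{Call}(s,0,v)=s$ and $\mathrm{Call}(s,k,0)=(s-k)^+$. A sequence $q=(q_1,\dots,q_M)$ in $\mathbb R^N_{\ge0}$ is a *martingale density* if $\sum_i q_j^i=\sum_i K^iq_j^i=1$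 for all $j$, and for each $2\le j\le M$ there is a nonnegative $N\times N$ matrix $P$ with $q_j=Pq_{j-1}$, $\sum_i P_{i\ell}=1$ and $\sum_i K^iP_{i\ell}=K^\ell$ for all $\ell$. A function $C:[0,\infty)^2\to[0,\infty)$ is an *arbitrage-free call price function* if there is a positive martingale $(Z_T)_{T\ge0}$ on some probability space with $Z_0=1$ a.s. and $C(T,K)=\mathbb E[(Z_T-K)^+]$ for all $T,K\geq 0$. It is *smooth* if $\partial_{KK}C(T,K)>0$ for all $T,K>0$, where derivatives in $K$ are right-hand derivatives. **Proposition (Interpolation).** (a) There are a martingale density $q$ and variances $0<V_1<\dots<V_M$ such that the functions $$\hat C_j(K)=\sum_{i=1}^N q_j^i\,\mathrm{Call}(K^i,K,V_j)$$ have the following properties. 1. They fit the market: $C_j^i\le\hat C_j(K^i)\le A_j^i$ for all $1\le j\le M$ and $0\le i\le N$. 2. Each $\hat C_j$ is $C^\infty$ on $(0,\infty)$ with $\hat C_j''>0$ there. 3. Put $\hat C_0(K)=(1-K)^+$, let $\alpha_j:[T_j,T_{j+1}]\to[0,1]$ ($0\le j<M$) be any nondecreasing functions with $\alpha_j(T_j)=0$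 and $\alpha_j(T_{j+1})=1$, and let $\hat C(T,K)=\alpha_j(T)\hat C_{j+1}(K)+(1-\alpha_j(T))\hat C_j(K)$ for $T\in[T_j,T_{j+1})$ and $\hat C(T,K)=\hat C_M(K)$ for $T\ge T_M$. Then $\hat C$ is an arbitrage-free call price function, and it is smooth if $\alpha_0>0$ on $(0,T_1)$. (b) Let $p_j^i=dC_j^i-dC_j^{i-1}$ for $1\le i\le N$, let $\hat C_j^{(\sigma)}(K)=\sum_{i=1}^N p_j^i\,\mathrm{Call}(K^i,K,\sigma^2T_j)$ for $\sigma>0$, and let $\bar C_j$ be the linear interpolation of $C_j^0,\dots,C_j^N$ on $[0,K^N]$, extended by $0$ to $K\ge K^N$. Then for every $j$, as $\sigma\downarrow0$, $\hat C_j^{(\sigma)}$ decreases to $\bar C_j$, uniformly on $[0,\infty)$. -/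

import Mathlib

open MeasureTheory ProbabilityTheory Filter Topology
open scoped NNReal ContDiff

noncomputable section

/-! ### Black–Scholes prices and call price surfaces -/

/-- The standard normal distribution function. -/
def stdNormalCDF (x : ℝ) : ℝ := cdf (gaussianReal 0 1) x

/-- The Black–Scholes call price with spot `s > 0`, strike `k ≥ 0` and total variance `v ≥ 0`:
`s N(d₊) - k N(d₋)` with `d± = (-log (k / s) ± v / 2) / √v`. The first two branches are the
values at `k = 0` (where `d± = +∞`, so the price is `s`) and at `v = 0` (intrinsic value). -/
def bsCall (s k v : ℝ) : ℝ :=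
  if k ≤ 0 then s - k
  else if v = 0 then max (s - k) 0
  else s * stdNormalCDF ((-Real.log (k / s) + v / 2) / √v)
    - k * stdNormalCDF ((-Real.log (k / s) - v / 2) / √v)

/-- A surface `C` (with arguments expiry `t ≥ 0` and strike `k ≥ 0`) is an arbitrage-free call
price function if it consists of the call prices on a positive martingale `Z` with `Z₀ = 1`. -/
def IsArbitrageFreeSurface (C : ℝ → ℝ → ℝ) : Prop :=
  ∃ (Ω : Type) (mΩ : MeasurableSpace Ω) (P : Measure Ω) (_ : IsProbabilityMeasure P)
    (ℱ : Filtration ℝ≥0 mΩ) (Z : ℝ≥0 → Ω → ℝ),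
    Martingale Z ℱ P ∧ (∀ t, ∀ᵐ w ∂P, 0 < Z t w) ∧ (∀ᵐ w ∂P, Z 0 w = 1) ∧
    ∀ t k : ℝ≥0, C t k = ∫ w, max (Z t w - k) 0 ∂P

/-- A surface is smooth in strike direction if `∂_KK C(T, K) > 0` for all `K > 0`, where
derivatives in `K` are right-hand derivatives. The expiry `T = 0` is left out, since an
arbitrage-free surface always has `C(0, K) = max (1 - K) 0`. -/
def IsSmoothSurface (C : ℝ → ℝ → ℝ) : Prop :=
  ∀ t, 0 < t → ∃ C' C'' : ℝ → ℝ, ∀ k, 0 < k →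
    HasDerivWithinAt (C t) (C' k) (Set.Ioi k) k ∧
    HasDerivWithinAt C' (C'' k) (Set.Ioi k) k ∧ 0 < C'' k

/-! ### Discrete markets
Strikes are `K 0 < ⋯ < K N` with `K 0 = 0`. The quoted expiries are numbered by `Fin M`. -/

/-- The slopes `dC i` of the call prices `c` on the strikes `K`, with `dC N = 0`. -/
def callSlope {N : ℕ} (K c : Fin (N + 1) → ℝ) : Fin (N + 1) → ℝ :=
  Fin.snoc (α := fun _ => ℝ)
    (fun i : Fin N => (c i.succ - c i.castSucc) / (K i.succ - K i.castSucc)) 0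

/-- Absence of arbitrage for market prices `C j i` (expiry `j`, strike `K i`). -/
structure IsArbitrageFreeMarket {M N : ℕ} (K : Fin (N + 1) → ℝ)
    (C : Fin M → Fin (N + 1) → ℝ) : Prop where
  unit_mean : ∀ j, C j 0 = 1
  zero_unattainable : ∀ j, callSlope K (C j) 0 = -1
  vanish : ∀ j, C j (Fin.last N) = 0
  convex : ∀ (j) (i : Fin N), callSlope K (C j) i.castSucc ≤ callSlope K (C j) i.succ
  calendar : ∀ j j', j ≤ j' → ∀ i, C j i ≤ C j' i

/-- The market density `p i = dC i - dC (i - 1)`, `i = 1, …, N`; the entry `i : Fin N` is the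
mass at the strike `K i.succ`. -/
def marketDensity {N : ℕ} (K c : Fin (N + 1) → ℝ) (i : Fin N) : ℝ :=
  callSlope K c i.succ - callSlope K c i.castSucc

/-- The linear interpolator of the call prices `c` in strike (zero beyond the last strike). -/
def linearInterp {N : ℕ} (K c : Fin (N + 1) → ℝ) (k : ℝ) : ℝ :=
  ∑ i : Fin N, if K i.castSucc ≤ k ∧ k < K i.succ then
    callSlope K c i.castSucc * (k - K i.succ) + c i.succ else 0

/-- `P` (columns indexed by the conditioning state) is a martingale transition operator on the
states `x`. -/
structure IsMartingaleTransition {N : ℕ} (x : Fin N → ℝ) (P : Matrix (Fin N) (Fin N) ℝ) :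
    Prop where
  nonneg : ∀ i l, 0 ≤ P i l
  col_sum : ∀ l, ∑ i, P i l = 1
  col_mean : ∀ l, ∑ i, x i * P i l = x l

/-- `q` is a sequence of densities on the states `x` with unit mean, in which consecutive members
are linked by martingale transition operators. -/
structure IsMartingaleDensity {M N : ℕ} (x : Fin N → ℝ) (q : Fin M → Fin N → ℝ) : Prop where
  nonneg : ∀ j i, 0 ≤ q j i
  sum_one : ∀ j, ∑ i, q j i = 1
  mean_one : ∀ j, ∑ i, x i * q j i = 1
  transition : ∀ j j' : Fin M, (j : ℕ) + 1 = j' →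
    ∃ P : Matrix (Fin N) (Fin N) ℝ, IsMartingaleTransition x P ∧ q j' = P.mulVec (q j)

/-! ### The model -/

/-- The model price `∑ i, q i * Call (x i, k, v)`. -/
def smoothCall {N : ℕ} (x q : Fin N → ℝ) (v k : ℝ) : ℝ := ∑ i, q i * bsCall (x i) k v

/-- `α` is a family of increasing interpolation weights between consecutive expiries `τ`. -/
structure IsTimeInterp {M : ℕ} (τ : Fin (M + 1) → ℝ) (α : Fin M → ℝ → ℝ) : Prop where
  mono : ∀ j, MonotoneOn (α j) (Set.Icc (τ j.castSucc) (τ j.succ))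
  left : ∀ j, α j (τ j.castSucc) = 0
  right : ∀ j, α j (τ j.succ) = 1

/-- The call prices per expiry, completed by `max (1 - k) 0` at expiry `0`. -/
def slices {M : ℕ} (c : Fin M → ℝ → ℝ) : Fin (M + 1) → ℝ → ℝ :=
  Fin.cons (α := fun _ => ℝ → ℝ) (fun k => max (1 - k) 0) c

/-- Interpolation in time with weights `α` of the prices `c j` at the expiries `τ j.succ` (and
`max (1 - k) 0` at `τ 0 = 0`), constant after the last expiry. -/
def timeInterp {M : ℕ} (τ : Fin (M + 1) → ℝ) (α : Fin M → ℝ → ℝ) (c : Fin M → ℝ → ℝ)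
    (t k : ℝ) : ℝ :=
  if τ (Fin.last M) ≤ t then slices c (Fin.last M) k
  else ∑ j : Fin M, if τ j.castSucc ≤ t ∧ t < τ j.succ then
    α j t * slices c j.succ k + (1 - α j t) * slices c j.castSucc k else 0

end

/-! The density is the market's own: `q j = marketDensity K (mid j)`, with variances `σ ^ 2 * τ
j.succ` for one small `σ`. Payoffs averaged under this density reproduce the linear interpolation of
the mid prices (`sum_marketDensity_mul_payoff`). Replacing payoffs by Black–Scholes prices adds a
time value that is nonnegative, increasing in the variance, and small for small variances uniformly
in the strike (`max_sub_le_bsCall`, `bsCall_mono`, `bsCall_sub_le`). This gives part (b). Since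
there are finitely many quotes and each mid is strictly below its ask, some `σ` fits them all.

Summation by parts turns calendar monotonicity of the mid prices into convex order of the densities
(`sum_mul_marketDensity_le`). A finite version of Strassen's theorem,
`exists_isMartingaleTransition`, then supplies the transition matrices by a separating hyperplane.

For absence of arbitrage, let `X` be the Markov chain on the strikes with these transitions, and `W`
an independent Gaussian process with independent increments and variances `V j`. Then `X j * exp (W
j - V j / 2)`, preceded by the constant 1, is a positive discrete martingale with the model prices
as call prices (`exists_martingale_smoothCall`). For intermediate times it is run along a clock
driven by an independent uniform variable `u`, which passes the next expiry once `α j t` exceeds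
`u`. Fubini preserves the martingale property, and averaging over `u` mixes adjacent slices with
weights `α j t` and `1 - α j t` (`isArbitrageFreeSurface_timeInterp`).

Smoothness holds because the second strike derivative of a Black–Scholes price is a lognormal
density, hence positive. -/

/-! ### Gaussian integrals and the Black–Scholes formula -/

/-- The reflected scaling `x ↦ m - √v * x` maps the standard normal law to the required one and
turns the upper ray into a lower ray, where the distribution function applies. -/
lemma gaussianReal_real_Ici (m a : ℝ) {v : ℝ≥0} (hv : v ≠ 0) :
    (gaussianReal m v).real (Set.Ici a) = stdNormalCDF ((m - a) / √v) := by
  have hs : 0 < √(v : ℝ) := Real.sqrt_pos.2 (by positivity)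
  have h1 : (gaussianReal 0 1).map (fun x => m - √(v : ℝ) * x) = gaussianReal m v := by
    have : (fun x => m - √(v : ℝ) * x) = (fun x => m - x) ∘ (fun x => √(v : ℝ) * x) := rfl
    rw [this, ← Measure.map_map (by fun_prop) (by fun_prop), gaussianReal_map_const_mul,
      gaussianReal_map_const_sub]
    congr 1
    · simp
    · ext; simp
  rw [stdNormalCDF, cdf_eq_real, ← h1, map_measureReal_apply (by fun_prop) measurableSet_Ici]
  congr 1
  ext x
  simp only [Set.mem_preimage, Set.mem_Ici, Set.mem_Iic, le_div_iff₀ hs]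
  constructor <;> intro h <;> linarith

/-- Completing the square: the exponential weight shifts the mean from `0` to `v`. This shift is the
difference between `d₊` and `d₋`. -/
lemma gaussianPDFReal_mul_exp (w : ℝ) {v : ℝ≥0} (hv : v ≠ 0) :
    gaussianPDFReal 0 v w * Real.exp (w - v / 2) = gaussianPDFReal v v w := by
  have : (v : ℝ) ≠ 0 := by exact_mod_cast hv
  simp only [gaussianPDFReal_def]
  rw [mul_assoc, ← Real.exp_add]
  congr 2
  field_simp
  ring

lemma integrable_exp_gaussianReal (v : ℝ≥0) :
    Integrable (fun w => Real.exp (w - v / 2)) (gaussianReal 0 v) := by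
  have := (integrable_exp_mul_gaussianReal (μ := 0) (v := v) 1).mul_const (Real.exp (-(v / 2)))
  simpa [← Real.exp_add, sub_eq_add_neg] using this

lemma integral_exp_mul_gaussianReal (t : ℝ) (v : ℝ≥0) :
    ∫ w, Real.exp (t * w) ∂(gaussianReal 0 v) = Real.exp (v * t ^ 2 / 2) := by
  have := congrFun (mgf_id_gaussianReal (μ := 0) (v := v)) t
  simpa [mgf] using this

lemma integral_exp_gaussianReal (v : ℝ≥0) :
    ∫ w, Real.exp (w - v / 2) ∂(gaussianReal 0 v) = 1 := by
  have h := integral_exp_mul_gaussianReal 1 v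
  simp only [one_mul, one_pow, mul_one] at h
  simp_rw [sub_eq_add_neg, Real.exp_add]
  rw [integral_mul_const, h, ← Real.exp_add, add_neg_cancel, Real.exp_zero]

lemma setIntegral_exp_gaussianReal (a : ℝ) {v : ℝ≥0} (hv : v ≠ 0) :
    ∫ w in Set.Ici a, Real.exp (w - v / 2) ∂(gaussianReal 0 v)
      = (gaussianReal v v).real (Set.Ici a) := by
  rw [← integral_indicator measurableSet_Ici, integral_gaussianReal_eq_integral_smul hv,
    measureReal_def, gaussianReal_apply_eq_integral _ hv, ENNReal.toReal_ofReal
    (integral_nonneg fun _ => gaussianPDFReal_nonneg _ _ _), ← integral_indicator measurableSet_Ici]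
  congr 1
  ext w
  by_cases hw : w ∈ Set.Ici a
  · simp [hw, gaussianPDFReal_mul_exp w hv]
  · simp [hw]

lemma integrable_payoff_gaussianReal (s k : ℝ) (v : ℝ≥0) :
    Integrable (fun w => max (s * Real.exp (w - v / 2) - k) 0) (gaussianReal 0 v) :=
  (((integrable_exp_gaussianReal v).const_mul s).sub (integrable_const k)).sup
    (integrable_const 0)

/-- The Black–Scholes price is the expected payoff of a call on a lognormal variable. -/
lemma bsCall_eq_integral {s k : ℝ} (hs : 0 < s) (hk : 0 ≤ k) (v : ℝ≥0) :
    bsCall s k v = ∫ w, max (s * Real.exp (w - v / 2) - k) 0 ∂(gaussianReal 0 v) := by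
  rcases hk.eq_or_lt with rfl | hk
  · have : ∀ w : ℝ, max (s * Real.exp (w - v / 2) - 0) 0 = s * Real.exp (w - v / 2) := fun w => by
      rw [sub_zero, max_eq_left (by positivity)]
    simp_rw [this]
    rw [integral_const_mul, integral_exp_gaussianReal]
    simp [bsCall]
  · by_cases hv : v = 0
    · subst hv
      simp [bsCall, hk.not_ge]
    have hv' : (v : ℝ) ≠ 0 := by exact_mod_cast hv
    rw [bsCall, if_neg hk.not_ge, if_neg hv']
    -- The exercise threshold: the payoff is nonnegative exactly for `w ≥ a`.
    set a : ℝ := Real.log (k / s) + v / 2 with ha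
    have hind : ∀ w : ℝ, max (s * Real.exp (w - v / 2) - k) 0
        = (Set.Ici a).indicator (fun w => s * Real.exp (w - v / 2) - k) w := by
      intro w
      have key : a ≤ w ↔ k ≤ s * Real.exp (w - v / 2) := by
        rw [← div_le_iff₀' hs, ← Real.log_le_iff_le_exp (by positivity)]
        constructor <;> intro h <;> linarith
      by_cases hw : a ≤ w
      · rw [Set.indicator_of_mem (show w ∈ Set.Ici a from hw),
          max_eq_left (sub_nonneg.2 (key.1 hw))]
      · rw [Set.indicator_of_notMem (show w ∉ Set.Ici a from hw), max_eq_right]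
        exact sub_nonpos.2 (not_le.1 (key.not.1 hw)).le
    simp_rw [hind]
    rw [integral_indicator measurableSet_Ici, integral_sub
      ((integrable_exp_gaussianReal v).const_mul s).integrableOn (integrable_const k).integrableOn,
      integral_const_mul, setIntegral_exp_gaussianReal a hv, setIntegral_const,
      gaussianReal_real_Ici _ _ hv, gaussianReal_real_Ici _ _ hv, smul_eq_mul, mul_comm k]
    congr 3
    · rw [ha]; ring_nf
    · rw [ha]; ring_nf

/-- Jensen's inequality for the payoff, since the lognormal factor has mean one. -/
lemma max_sub_le_bsCall {s k : ℝ} (hs : 0 < s) (hk : 0 ≤ k) (v : ℝ≥0) :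
    max (s - k) 0 ≤ bsCall s k v := by
  rw [bsCall_eq_integral hs hk]
  refine max_le ?_ (integral_nonneg fun w => le_max_right _ _)
  have h : ∫ w, (s * Real.exp (w - v / 2) - k) ∂(gaussianReal 0 v) = s - k := by
    rw [integral_sub ((integrable_exp_gaussianReal v).const_mul s) (integrable_const k),
      integral_const_mul, integral_exp_gaussianReal]
    simp
  rw [← h]
  exact integral_mono (((integrable_exp_gaussianReal v).const_mul s).sub (integrable_const k))
    (integrable_payoff_gaussianReal s k v) fun w => le_max_left _ _

lemma integral_gaussianReal_comp_add (f : ℝ → ℝ) (m : ℝ) (v : ℝ≥0) (hf : Measurable f) :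
    ∫ x, f (m + x) ∂(gaussianReal 0 v) = ∫ x, f x ∂(gaussianReal m v) := by
  have h := gaussianReal_map_const_add (μ := 0) (v := v) m
  rw [zero_add] at h
  rw [← h, integral_map (by fun_prop) hf.aestronglyMeasurable]

/-- A Gaussian of variance `v + δ` is a sum of independent ones of variances `v` and `δ`. Given the
first summand `w`, the second integrates to a Black–Scholes price with spot `s * exp (w - v / 2)`
and variance `δ`, which dominates its intrinsic value. -/
lemma bsCall_le_bsCall_add {s k : ℝ} (hs : 0 < s) (hk : 0 ≤ k) (v δ : ℝ≥0) :
    bsCall s k v ≤ bsCall s k ((v + δ : ℝ≥0) : ℝ) := by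
  have hconv := gaussianReal_conv_gaussianReal (m₁ := 0) (m₂ := 0) (v₁ := v) (v₂ := δ)
  rw [add_zero] at hconv
  have hint := integrable_payoff_gaussianReal s k (v + δ)
  rw [← hconv] at hint
  rw [bsCall_eq_integral hs hk, bsCall_eq_integral hs hk, ← hconv, integral_conv hint]
  have hint' := (integrable_conv_iff hint.aestronglyMeasurable).1 hint
  have hint2 := ((integrable_map_measure hint.aestronglyMeasurable (by fun_prop)).1
    hint).integral_prod_left
  refine integral_mono (integrable_payoff_gaussianReal s k v) hint2 fun w => ?_
  have hs' : 0 < s * Real.exp (w - v / 2) := by positivity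
  refine (max_sub_le_bsCall hs' hk δ).trans_eq ?_
  rw [bsCall_eq_integral hs' hk]
  congr 1 with x
  rw [mul_assoc, ← Real.exp_add, NNReal.coe_add]
  congr 4
  ring

lemma bsCall_mono {s k : ℝ} (hs : 0 < s) (hk : 0 ≤ k) {v w : ℝ} (hv : 0 ≤ v) (hvw : v ≤ w) :
    bsCall s k v ≤ bsCall s k w := by
  lift v to ℝ≥0 using hv
  have h := bsCall_le_bsCall_add hs hk v (w - v).toNNReal
  rwa [NNReal.coe_add, Real.coe_toNNReal _ (sub_nonneg.2 hvw), add_sub_cancel] at h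

/-- The time value of a call is small for small variances, uniformly in the strike. -/
lemma bsCall_sub_le {s k : ℝ} (hs : 0 < s) (hk : 0 ≤ k) (v : ℝ≥0) {ε : ℝ} (hε : 0 < ε) :
    bsCall s k v - max (s - k) 0 ≤ s * (((Real.exp v - 1) / ε + ε) / 2) := by
  have hi1 := integrable_exp_gaussianReal v
  have e2 : ∀ w : ℝ, (Real.exp (w - v / 2) - 1) ^ 2
      = Real.exp (2 * w) * Real.exp (-v) - 2 * Real.exp (w - v / 2) + 1 := fun w => by
    rw [sub_sq, ← Real.exp_nat_mul, ← Real.exp_add]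
    push_cast
    ring_nf
  have hi2 : Integrable (fun w => (Real.exp (w - v / 2) - 1) ^ 2) (gaussianReal 0 v) := by
    simp_rw [e2]
    exact (((integrable_exp_mul_gaussianReal 2).mul_const _).sub (hi1.const_mul 2)).add
      (integrable_const _)
  -- The variance of the mean-one lognormal variable.
  have hsq : ∫ w, (Real.exp (w - v / 2) - 1) ^ 2 ∂(gaussianReal 0 v) = Real.exp v - 1 := by
    simp_rw [e2]
    have hi3 : Integrable (fun w => Real.exp (2 * w) * Real.exp (-v)) (gaussianReal 0 v) :=
      (integrable_exp_mul_gaussianReal 2).mul_const _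
    have hi4 : Integrable (fun w => Real.exp (2 * w) * Real.exp (-v) - 2 * Real.exp (w - v / 2))
      (gaussianReal 0 v) := hi3.sub (hi1.const_mul 2)
    rw [integral_add hi4 (integrable_const _), integral_sub hi3 (hi1.const_mul 2),
      integral_mul_const, integral_const_mul, integral_exp_gaussianReal,
      integral_exp_mul_gaussianReal, ← Real.exp_add]
    simp only [integral_const, probReal_univ, smul_eq_mul]
    ring_nf
  rw [bsCall_eq_integral hs hk, ← hsq, sub_le_iff_le_add]
  -- The payoff is 1-Lipschitz in the terminal spot, so its excess over the intrinsic value is at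
  -- most `s * |x|`. The bound `|x| ≤ (x ^ 2 / ε + ε) / 2` then passes to second moments, in place
  -- of Cauchy–Schwarz.
  have hbound : ∀ w : ℝ, max (s * Real.exp (w - v / 2) - k) 0 ≤
      s * (((Real.exp (w - v / 2) - 1) ^ 2 / ε + ε) / 2) + max (s - k) 0 := by
    intro w
    set x := Real.exp (w - v / 2) - 1 with hx
    have h1 : |x| ≤ (x ^ 2 / ε + ε) / 2 := by
      rw [le_div_iff₀ two_pos, ← sub_nonneg]
      have : x ^ 2 / ε + ε - |x| * 2 = (|x| - ε) ^ 2 / ε := by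
        field_simp
        rw [← sq_abs x]
        ring
      rw [this]; positivity
    have h2 : s * Real.exp (w - v / 2) - k ≤ s * |x| + (s - k) := by
      have := mul_le_mul_of_nonneg_left (le_abs_self x) hs.le
      rw [hx] at this ⊢
      linarith
    have h3 := mul_le_mul_of_nonneg_left h1 hs.le
    refine max_le ?_ ?_
    · linarith [le_max_left (s - k) 0]
    · have : 0 ≤ s * |x| := by positivity
      linarith [le_max_right (s - k) 0]
  have hi5 : Integrable (fun w : ℝ => (Real.exp (w - v / 2) - 1) ^ 2 / ε + ε)
    (gaussianReal 0 v) := (hi2.div_const ε).add (integrable_const ε)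
  have hi6 : Integrable (fun w : ℝ => s * (((Real.exp (w - v / 2) - 1) ^ 2 / ε + ε) / 2))
    (gaussianReal 0 v) := (hi5.div_const 2).const_mul s
  refine (integral_mono (integrable_payoff_gaussianReal s k v)
    (hi6.add (integrable_const (max (s - k) 0))) hbound).trans_eq ?_
  rw [Pi.add_def, integral_add hi6 (integrable_const _), integral_const_mul, integral_div,
    integral_add (hi2.div_const ε) (integrable_const ε), integral_div]
  simp

/-! ### Smoothness in the strike -/

lemma contDiff_gaussianPDFReal (m : ℝ) (v : ℝ≥0) : ContDiff ℝ ∞ (gaussianPDFReal m v) := by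
  unfold gaussianPDFReal
  fun_prop

lemma hasDerivAt_stdNormalCDF (x : ℝ) :
    HasDerivAt stdNormalCDF (gaussianPDFReal 0 1 x) x := by
  have hint := integrable_gaussianPDFReal 0 1
  have hcont : Continuous (gaussianPDFReal 0 1) := (contDiff_gaussianPDFReal 0 1).continuous
  have h : stdNormalCDF = fun x =>
      (∫ y in Set.Iic 0, gaussianPDFReal 0 1 y) + ∫ y in (0 : ℝ)..x, gaussianPDFReal 0 1 y := by
    ext x
    rw [← intervalIntegral.integral_Iic_sub_Iic hint.integrableOn hint.integrableOn,
      add_sub_cancel, stdNormalCDF, cdf_eq_real, measureReal_def,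
      gaussianReal_apply_eq_integral _ one_ne_zero, ENNReal.toReal_ofReal
      (integral_nonneg fun _ => gaussianPDFReal_nonneg _ _ _)]
  rw [h]
  exact (intervalIntegral.integral_hasDerivAt_right hint.intervalIntegrable
    hcont.aestronglyMeasurable.stronglyMeasurableAtFilter hcont.continuousAt).const_add _

lemma contDiff_stdNormalCDF : ContDiff ℝ ∞ stdNormalCDF := by
  refine contDiff_infty_iff_deriv.2 ⟨fun x => (hasDerivAt_stdNormalCDF x).differentiableAt, ?_⟩
  rw [funext fun x => (hasDerivAt_stdNormalCDF x).deriv]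
  exact contDiff_gaussianPDFReal 0 1

/-- The strike derivative of the Black–Scholes price. -/
noncomputable def bsStrikeDeriv (s v k : ℝ) : ℝ :=
  -stdNormalCDF ((-Real.log (k / s) - v / 2) / √v)

/-- The second strike derivative of the Black–Scholes price. -/
noncomputable def bsStrikeDeriv₂ (s v k : ℝ) : ℝ :=
  gaussianPDFReal 0 1 ((-Real.log (k / s) - v / 2) / √v) / (k * √v)

lemma bsStrikeDeriv₂_pos {s v k : ℝ} (hv : 0 < v) (hk : 0 < k) : 0 < bsStrikeDeriv₂ s v k :=
  div_pos (gaussianPDFReal_pos _ _ _ one_ne_zero) (mul_pos hk (Real.sqrt_pos.2 hv))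

lemma bsCall_of_pos {s k v : ℝ} (hk : 0 < k) (hv : 0 < v) :
    bsCall s k v = s * stdNormalCDF ((-Real.log (k / s) + v / 2) / √v)
      - k * stdNormalCDF ((-Real.log (k / s) - v / 2) / √v) := by
  rw [bsCall, if_neg hk.not_ge, if_neg hv.ne']

/-- Holds because `d₊ ^ 2 - d₋ ^ 2 = -2 * log (k / s)`. It cancels the density terms in the strike
derivative of the price, leaving only `-N(d₋)`. -/
lemma mul_gaussianPDFReal_dplus {s k v : ℝ} (hs : 0 < s) (hk : 0 < k) (hv : 0 < v) :
    s * gaussianPDFReal 0 1 ((-Real.log (k / s) + v / 2) / √v)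
      = k * gaussianPDFReal 0 1 ((-Real.log (k / s) - v / 2) / √v) := by
  have hexp : k = s * Real.exp (Real.log (k / s)) := by
    rw [Real.exp_log (by positivity)]; field_simp
  set l := Real.log (k / s)
  rw [hexp]
  simp only [gaussianPDFReal_def, sub_zero, NNReal.coe_one, mul_one]
  rw [mul_assoc, mul_left_comm (Real.exp l), ← Real.exp_add]
  congr 3
  rw [div_pow, div_pow, Real.sq_sqrt hv.le]
  field_simp
  ring

lemma hasDerivAt_log_strike {s k : ℝ} (hs : 0 < s) (hk : 0 < k) (c v : ℝ) :
    HasDerivAt (fun k => (-Real.log (k / s) + c) / √v) (-(1 / (k * √v))) k := by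
  have h1 : HasDerivAt (fun k => Real.log (k / s)) (1 / k) k := by
    have := ((hasDerivAt_id k).div_const s).log (by simpa using (div_pos hk hs).ne')
    convert! this using 1
    simp only [id]
    field_simp
  convert! (h1.neg.add_const c).div_const √v using 1
  rw [neg_div, div_div]

lemma hasDerivAt_bsStrikeDeriv {s k v : ℝ} (hs : 0 < s) (hk : 0 < k) :
    HasDerivAt (bsStrikeDeriv s v) (bsStrikeDeriv₂ s v k) k := by
  have h := ((hasDerivAt_stdNormalCDF _).comp k (hasDerivAt_log_strike hs hk (-(v / 2)) v)).neg
  simp only [← sub_eq_add_neg] at h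
  convert! h using 1
  rw [bsStrikeDeriv₂]
  ring

lemma hasDerivAt_bsCall {s k v : ℝ} (hs : 0 < s) (hk : 0 < k) (hv : 0 < v) :
    HasDerivAt (fun k => bsCall s k v) (bsStrikeDeriv s v k) k := by
  have h1 := ((hasDerivAt_stdNormalCDF _).comp k
    (hasDerivAt_log_strike hs hk (v / 2) v)).const_mul s
  have h2 := (hasDerivAt_id k).mul
    ((hasDerivAt_stdNormalCDF _).comp k (hasDerivAt_log_strike hs hk (-(v / 2)) v))
  have h := h1.sub h2
  simp only [← sub_eq_add_neg] at h
  refine (h.congr_of_eventuallyEq ?_).congr_deriv ?_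
  · filter_upwards [Ioi_mem_nhds hk] with x hx
    exact bsCall_of_pos hx hv
  have hm := mul_gaussianPDFReal_dplus hs hk hv
  simp only [bsStrikeDeriv, Function.comp, id, one_mul]
  linear_combination (-1 / (k * √v)) * hm

lemma contDiffOn_bsCall {s v : ℝ} (hs : 0 < s) (hv : 0 < v) :
    ContDiffOn ℝ ∞ (fun k => bsCall s k v) (Set.Ioi 0) := by
  have hlog : ContDiffOn ℝ ∞ (fun k => Real.log (k / s)) (Set.Ioi 0) :=
    (contDiffOn_id.div_const s).log fun x hx => (div_pos hx hs).ne'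
  have h1 : ContDiffOn ℝ ∞ (fun k => stdNormalCDF ((-Real.log (k / s) + v / 2) / √v))
      (Set.Ioi 0) :=
    contDiff_stdNormalCDF.comp_contDiffOn ((hlog.neg.add contDiffOn_const).div_const _)
  have h2 : ContDiffOn ℝ ∞ (fun k => stdNormalCDF ((-Real.log (k / s) - v / 2) / √v))
      (Set.Ioi 0) :=
    contDiff_stdNormalCDF.comp_contDiffOn ((hlog.neg.sub contDiffOn_const).div_const _)
  exact ((contDiffOn_const.mul h1).sub (contDiffOn_id.mul h2)).congr
    fun k hk => bsCall_of_pos hk hv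

section smoothCall

variable {N : ℕ} {x q : Fin N → ℝ} {v k : ℝ}

lemma hasDerivAt_smoothCall (hx : ∀ i, 0 < x i) (hv : 0 < v) (hk : 0 < k) :
    HasDerivAt (smoothCall x q v) (∑ i, q i * bsStrikeDeriv (x i) v k) k :=
  HasDerivAt.fun_sum fun i _ => (hasDerivAt_bsCall (hx i) hk hv).const_mul (q i)

lemma hasDerivAt_smoothCall_deriv (hx : ∀ i, 0 < x i) (hk : 0 < k) :
    HasDerivAt (fun k => ∑ i, q i * bsStrikeDeriv (x i) v k)
      (∑ i, q i * bsStrikeDeriv₂ (x i) v k) k :=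
  HasDerivAt.fun_sum fun i _ => (hasDerivAt_bsStrikeDeriv (hx i) hk).const_mul (q i)

lemma sum_mul_bsStrikeDeriv₂_pos (hq : ∀ i, 0 ≤ q i) (hq1 : ∑ i, q i = 1) (hv : 0 < v)
    (hk : 0 < k) : 0 < ∑ i, q i * bsStrikeDeriv₂ (x i) v k := by
  obtain ⟨i, -, hi⟩ : ∃ i ∈ Finset.univ, 0 < q i :=
    Finset.exists_lt_of_sum_lt (by simp [hq1])
  exact Finset.sum_pos' (fun i _ => mul_nonneg (hq i) (bsStrikeDeriv₂_pos hv hk).le)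
    ⟨i, Finset.mem_univ i, mul_pos hi (bsStrikeDeriv₂_pos hv hk)⟩

lemma contDiffOn_smoothCall (hx : ∀ i, 0 < x i) (hv : 0 < v) :
    ContDiffOn ℝ ∞ (smoothCall x q v) (Set.Ioi 0) :=
  ContDiffOn.sum fun i _ => contDiffOn_const.mul (contDiffOn_bsCall (hx i) hv)

lemma iteratedDeriv_two_smoothCall (hx : ∀ i, 0 < x i) (hv : 0 < v) (hk : 0 < k) :
    iteratedDeriv 2 (smoothCall x q v) k = ∑ i, q i * bsStrikeDeriv₂ (x i) v k := by
  have h : deriv (smoothCall x q v) =ᶠ[𝓝 k] fun k => ∑ i, q i * bsStrikeDeriv (x i) v k := by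
    filter_upwards [Ioi_mem_nhds hk] with y hy
    exact (hasDerivAt_smoothCall hx hv hy).deriv
  rw [iteratedDeriv_succ, iteratedDeriv_one, h.deriv_eq, (hasDerivAt_smoothCall_deriv hx hk).deriv]

end smoothCall

/-! ### Market densities -/

section market

variable {N : ℕ} {K c : Fin (N + 1) → ℝ}

lemma callSlope_castSucc (i : Fin N) : callSlope K c i.castSucc =
    (c i.succ - c i.castSucc) / (K i.succ - K i.castSucc) := by
  simp [callSlope]

lemma callSlope_last : callSlope K c (Fin.last N) = 0 := by simp [callSlope]

lemma Fin.sum_succ_sub_castSucc (f : Fin (N + 1) → ℝ) :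
    ∑ i : Fin N, (f i.succ - f i.castSucc) = f (Fin.last N) - f 0 := by
  rw [Finset.sum_sub_distrib]
  have h1 := Fin.sum_univ_succ f
  have h2 := Fin.sum_univ_castSucc f
  linarith

lemma callSlope_mul_sub (hK : StrictMono K) (i : Fin N) :
    callSlope K c i.castSucc * (K i.succ - K i.castSucc) = c i.succ - c i.castSucc := by
  rw [callSlope_castSucc, div_mul_cancel₀]
  exact (sub_pos.2 (hK i.castSucc_lt_succ)).ne'

/-- The payoffs of calls under the market density are the linearly interpolated prices. -/
lemma sum_marketDensity_mul_payoff (hK : StrictMono K) (hK0 : K 0 = 0)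
    (hc : c (Fin.last N) = 0) {k : ℝ} (hk : 0 ≤ k) :
    ∑ i : Fin N, marketDensity K c i * max (K i.succ - k) 0 = linearInterp K c k := by
  -- `L i` is the line through node `i` with slope `dC i`, evaluated at `k`. The lines of index
  -- `i.castSucc` and `i.succ` meet at strike `K i.succ`, so they differ at `k` by the density times
  -- `k - K i.succ`, and the sum of the payoffs telescopes. The interval containing `k` contributes
  -- the interpolated value. The boundary terms vanish: `h 0 = 0` because `k ≥ K 0`, and the last
  -- price and slope are zero.
  set h : Fin (N + 1) → ℝ := fun i => if k < K i then 1 else 0 with hh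
  set L : Fin (N + 1) → ℝ := fun i => c i + callSlope K c i * (k - K i) with hL
  have key : ∀ i : Fin N, marketDensity K c i * max (K i.succ - k) 0
      - (if K i.castSucc ≤ k ∧ k < K i.succ then
          callSlope K c i.castSucc * (k - K i.succ) + c i.succ else 0)
      = -(h i.succ * L i.succ - h i.castSucc * L i.castSucc) := by
    intro i
    have hlt := hK i.castSucc_lt_succ
    have hsl := callSlope_mul_sub (c := c) hK i
    simp only [hh, hL, marketDensity]
    by_cases h1 : k < K i.castSucc
    · have h2 := h1.trans hlt
      rw [max_eq_left (by linarith), if_neg (fun h => h.1.not_gt h1), if_pos h1, if_pos h2]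
      linear_combination -hsl
    · by_cases h2 : k < K i.succ
      · rw [max_eq_left (by linarith), if_pos ⟨not_lt.1 h1, h2⟩, if_neg h1, if_pos h2]
        ring
      · rw [max_eq_right (by linarith), if_neg (fun h => h2 h.2), if_neg h1, if_neg h2]
        ring
  have hsum := Finset.sum_congr rfl fun i (_ : i ∈ Finset.univ) => key i
  rw [Finset.sum_sub_distrib, Finset.sum_neg_distrib,
    Fin.sum_succ_sub_castSucc fun i => h i * L i] at hsum
  have h0 : h 0 = 0 := by simp [hh, hK0, hk]
  have hN : L (Fin.last N) = 0 := by simp [hL, hc, callSlope_last]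
  rw [h0, hN, mul_zero, zero_mul, sub_zero, neg_zero, sub_eq_zero] at hsum
  exact hsum

lemma linearInterp_node (hK : StrictMono K) (hc : c (Fin.last N) = 0) (i : Fin (N + 1)) :
    linearInterp K c (K i) = c i := by
  unfold linearInterp
  induction i using Fin.lastCases with
  | last =>
    rw [hc]
    refine Finset.sum_eq_zero fun j _ => if_neg fun h => ?_
    exact h.2.not_ge (hK.monotone (Fin.le_last _))
  | cast i =>
    rw [Finset.sum_eq_single i]
    · rw [if_pos ⟨le_rfl, hK i.castSucc_lt_succ⟩]
      linear_combination -callSlope_mul_sub (c := c) hK i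
    · intro j _ hj
      refine if_neg fun h => hj ?_
      have h1 := hK.le_iff_le.1 h.1
      have h2 := hK.lt_iff_lt.1 h.2
      simp only [Fin.le_def, Fin.lt_def, Fin.val_castSucc, Fin.val_succ] at h1 h2
      ext; omega
    · simp

lemma marketDensity_nonneg (h : ∀ i : Fin N, callSlope K c i.castSucc ≤ callSlope K c i.succ)
    (i : Fin N) : 0 ≤ marketDensity K c i :=
  sub_nonneg.2 (h i)

lemma sum_marketDensity (h : callSlope K c 0 = -1) : ∑ i, marketDensity K c i = 1 := by
  simp only [marketDensity]
  rw [Fin.sum_succ_sub_castSucc, callSlope_last, h]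
  norm_num

lemma succ_strike_pos (hK : StrictMono K) (hK0 : K 0 = 0) (i : Fin N) : 0 < K i.succ :=
  hK0 ▸ hK (Fin.succ_pos i)

/-- The mean is the price of the call struck at zero. -/
lemma sum_mul_marketDensity (hK : StrictMono K) (hK0 : K 0 = 0)
    (hc : c (Fin.last N) = 0) (hc0 : c 0 = 1) :
    ∑ i : Fin N, K i.succ * marketDensity K c i = 1 := by
  have h := sum_marketDensity_mul_payoff hK hK0 hc le_rfl
  have h2 := linearInterp_node hK hc 0
  rw [hK0] at h2
  rw [h2, hc0] at h
  rw [← h]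
  refine Finset.sum_congr rfl fun i _ => ?_
  rw [sub_zero, max_eq_left (succ_strike_pos hK hK0 i).le, mul_comm]

end market

/-! ### Bounds on the model prices and the limit of vanishing variance -/

section smoothCall

variable {N : ℕ} {x q : Fin N → ℝ} {k : ℝ}

lemma sum_payoff_le_smoothCall (hx : ∀ i, 0 < x i) (hq : ∀ i, 0 ≤ q i) (hk : 0 ≤ k) {v : ℝ}
    (hv : 0 ≤ v) : ∑ i, q i * max (x i - k) 0 ≤ smoothCall x q v k := by
  lift v to ℝ≥0 using hv
  exact Finset.sum_le_sum fun i _ =>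
    mul_le_mul_of_nonneg_left (max_sub_le_bsCall (hx i) hk v) (hq i)

lemma smoothCall_mono (hx : ∀ i, 0 < x i) (hq : ∀ i, 0 ≤ q i) (hk : 0 ≤ k) {v w : ℝ}
    (hv : 0 ≤ v) (hvw : v ≤ w) : smoothCall x q v k ≤ smoothCall x q w k :=
  Finset.sum_le_sum fun i _ => mul_le_mul_of_nonneg_left (bsCall_mono (hx i) hk hv hvw) (hq i)

/-- The bound for each single call is proportional to its spot, so unit mean makes the total
independent of the density and of the strike. -/
lemma smoothCall_sub_le (hx : ∀ i, 0 < x i) (hq : ∀ i, 0 ≤ q i) (hmean : ∑ i, x i * q i = 1)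
    (hk : 0 ≤ k) {v : ℝ} (hv : 0 ≤ v) {ε : ℝ} (hε : 0 < ε) :
    smoothCall x q v k - ∑ i, q i * max (x i - k) 0 ≤ ((Real.exp v - 1) / ε + ε) / 2 := by
  lift v to ℝ≥0 using hv
  rw [smoothCall, ← Finset.sum_sub_distrib]
  calc _ ≤ ∑ i, x i * q i * (((Real.exp v - 1) / ε + ε) / 2) := by
        refine Finset.sum_le_sum fun i _ => ?_
        rw [← mul_sub, mul_comm (x i), mul_assoc]
        exact mul_le_mul_of_nonneg_left (bsCall_sub_le (hx i) hk v hε) (hq i)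
    _ = _ := by rw [← Finset.sum_mul, hmean, one_mul]

lemma tendstoUniformlyOn_smoothCall (hx : ∀ i, 0 < x i) (hq : ∀ i, 0 ≤ q i)
    (hmean : ∑ i, x i * q i = 1) {t : ℝ} (ht : 0 ≤ t) :
    TendstoUniformlyOn (fun σ k => smoothCall x q (σ ^ 2 * t) k)
      (fun k => ∑ i, q i * max (x i - k) 0) (𝓝[>] 0) (Set.Ici 0) := by
  rw [Metric.tendstoUniformlyOn_iff]
  intro ε hε
  -- The tolerance itself serves as the free parameter `ε` of the bound, whose limit `ε / 2` is
  -- below the tolerance.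
  have hlim : Tendsto (fun σ : ℝ => ((Real.exp (σ ^ 2 * t) - 1) / ε + ε) / 2) (𝓝[>] 0)
      (𝓝 (ε / 2)) := by
    have : Continuous fun σ : ℝ => ((Real.exp (σ ^ 2 * t) - 1) / ε + ε) / 2 := by fun_prop
    simpa using (this.tendsto 0).mono_left nhdsWithin_le_nhds
  filter_upwards [hlim.eventually_lt_const (half_lt_self hε)] with σ hσ k hk
  have hv : 0 ≤ σ ^ 2 * t := by positivity
  rw [dist_comm, Real.dist_eq, abs_of_nonneg (sub_nonneg.2 (sum_payoff_le_smoothCall hx hq hk hv))]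
  exact (smoothCall_sub_le hx hq hmean hk hv hε).trans_lt hσ

end smoothCall

/-! ### Martingale transitions between densities in convex order -/

section transition

variable {N : ℕ} {x : Fin N → ℝ}

/-- The probability vectors on the states `x` with mean `m`. -/
def densitiesWithMean (x : Fin N → ℝ) (m : ℝ) : Set (Fin N → ℝ) :=
  {d | (∀ i, 0 ≤ d i) ∧ ∑ i, d i = 1 ∧ ∑ i, x i * d i = m}

lemma isCompact_densitiesWithMean (x : Fin N → ℝ) (m : ℝ) :
    IsCompact (densitiesWithMean x m) := by
  refine (isCompact_Icc (a := (0 : Fin N → ℝ)) (b := 1)).of_isClosed_subset ?_ ?_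
  · have h1 : IsClosed {d : Fin N → ℝ | ∀ i, 0 ≤ d i} := by
      simp only [Set.ofPred_forall]
      exact isClosed_iInter fun i => isClosed_le continuous_const (continuous_apply i)
    have h2 : IsClosed {d : Fin N → ℝ | ∑ i, d i = 1} :=
      isClosed_eq (by fun_prop) continuous_const
    have h3 : IsClosed {d : Fin N → ℝ | ∑ i, x i * d i = m} :=
      isClosed_eq (by fun_prop) continuous_const
    exact h1.inter (h2.inter h3)
  · rintro d ⟨h0, h1, -⟩
    exact ⟨h0, fun i =>
      (Finset.single_le_sum (fun j _ => h0 j) (Finset.mem_univ i)).trans_eq h1⟩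

lemma convex_densitiesWithMean (x : Fin N → ℝ) (m : ℝ) : Convex ℝ (densitiesWithMean x m) := by
  rintro d ⟨h0, h1, h2⟩ e ⟨g0, g1, g2⟩ a b ha hb hab
  refine ⟨fun i => add_nonneg (mul_nonneg ha (h0 i)) (mul_nonneg hb (g0 i)), ?_, ?_⟩
  · simp [Finset.sum_add_distrib, ← Finset.mul_sum, h1, g1, hab]
  · simp only [Pi.add_apply, Pi.smul_apply, smul_eq_mul, mul_add, Finset.sum_add_distrib,
      mul_left_comm _ a, mul_left_comm _ b, ← Finset.mul_sum, h2, g2]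
    rw [← add_mul, hab, one_mul]

lemma single_mem_densitiesWithMean (x : Fin N → ℝ) (l : Fin N) :
    Pi.single l 1 ∈ densitiesWithMean x (x l) :=
  ⟨fun i => by by_cases h : i = l <;> simp [h], by simp, by simp [Pi.single_apply]⟩

/-- Running a martingale transition with columns `d l` from the law `e` preserves the mean. -/
lemma sum_mul_mem_densitiesWithMean {d : Fin N → Fin N → ℝ} {e : Fin N → ℝ} {m : ℝ}
    (hd : ∀ l, d l ∈ densitiesWithMean x (x l)) (he : e ∈ densitiesWithMean x m) :
    (fun i => ∑ l, d l i * e l) ∈ densitiesWithMean x m := by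
  refine ⟨fun i => Finset.sum_nonneg fun l _ => mul_nonneg ((hd l).1 i) (he.1 l), ?_, ?_⟩
  · rw [Finset.sum_comm]
    simp_rw [← Finset.sum_mul, (hd _).2.1, one_mul, he.2.1]
  · simp_rw [Finset.mul_sum, ← mul_assoc]
    rw [Finset.sum_comm]
    simp_rw [← Finset.sum_mul, (hd _).2.2, he.2.2]

/-- Jensen's inequality for the densities on the states `x`. -/
def IsConcaveOnStates (x F : Fin N → ℝ) : Prop :=
  ∀ l, ∀ d ∈ densitiesWithMean x (x l), ∑ i, F i * d i ≤ F l

/-- Two densities in convex order are linked by a martingale transition. -/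
theorem exists_isMartingaleTransition {p q : Fin N → ℝ} (hq : ∀ i, 0 ≤ q i)
    (hpq : ∀ F, IsConcaveOnStates x F → ∑ i, F i * q i ≤ ∑ i, F i * p i) :
    ∃ P : Matrix (Fin N) (Fin N) ℝ, IsMartingaleTransition x P ∧ q = P.mulVec p := by
  set D : Fin N → Set (Fin N → ℝ) := fun l => densitiesWithMean x (x l) with hD
  -- `A` sends a choice of columns to the law reached from `p`. The image of the admissible columns
  -- is compact and convex, and the claim is that it contains `q`.
  let A : (Fin N → Fin N → ℝ) →ₗ[ℝ] (Fin N → ℝ) :=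
    { toFun := fun d i => ∑ l, d l i * p l
      map_add' := fun d e => by ext i; simp [add_mul, Finset.sum_add_distrib]
      map_smul' := fun a d => by ext i; simp [Finset.mul_sum, mul_assoc] }
  have hA : ∀ d i, A d i = ∑ l, d l i * p l := fun _ _ => rfl
  have hAc : Continuous A := A.continuous_of_finiteDimensional
  by_cases hmem : q ∈ A '' Set.univ.pi D
  · obtain ⟨d, hd, rfl⟩ := hmem
    have hd' : ∀ l, d l ∈ D l := fun l => hd l trivial
    refine ⟨Matrix.of fun i l => d l i, ⟨fun i l => (hd' l).1 i, fun l => (hd' l).2.1,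
      fun l => (hd' l).2.2⟩, ?_⟩
    ext i
    simp [hA, Matrix.mulVec, dotProduct]
  exfalso
  -- Otherwise a linear functional, with coefficients `c`, is below `u` on every reachable law and
  -- above `u` at `q`.
  obtain ⟨f, u, hf1, hf2⟩ := geometric_hahn_banach_closed_point
    ((convex_pi fun l _ => convex_densitiesWithMean x (x l)).linear_image A)
    ((isCompact_univ_pi fun l => isCompact_densitiesWithMean x (x l)).image hAc).isClosed hmem
  set c : Fin N → ℝ := fun i => f (Pi.single i 1) with hc
  have hf : ∀ v, f v = ∑ i, c i * v i := fun v => by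
    have := LinearMap.pi_apply_eq_sum_univ (f : (Fin N → ℝ) →ₗ[ℝ] ℝ) v
    simp only [ContinuousLinearMap.coe_coe, smul_eq_mul] at this
    rw [this]
    refine Finset.sum_congr rfl fun i _ => ?_
    rw [hc, mul_comm]
    congr 2
    ext j
    simp [Pi.single_apply, eq_comm]
  -- `F l` will be the largest mean of `c` over admissible columns at state `l`: the concave
  -- envelope of `c` on the states.
  have hmax : ∀ l, ∃ d ∈ D l, ∀ e ∈ D l, ∑ i, c i * e i ≤ ∑ i, c i * d i := fun l =>
    (isCompact_densitiesWithMean x (x l)).exists_isMaxOn ⟨_, single_mem_densitiesWithMean x l⟩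
      (f := fun d => ∑ i, c i * d i) (by fun_prop)
  choose d hd hdmax using hmax
  set F : Fin N → ℝ := fun l => ∑ i, c i * d l i with hF
  have hswap : ∀ e : Fin N → ℝ, ∑ l, F l * e l = ∑ i, c i * ∑ l, d l i * e l := fun e => by
    simp_rw [hF, Finset.sum_mul, Finset.mul_sum, mul_assoc]
    exact Finset.sum_comm
  -- A mixture of the maximising columns competes in the maximum that defines `F l`.
  have hFc : IsConcaveOnStates x F := fun l e he => by
    rw [hswap]
    exact hdmax l _ (sum_mul_mem_densitiesWithMean hd he)
  have h1 : ∑ i, F i * p i < u := by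
    rw [hswap]
    have := hf1 (A d) ⟨d, fun l _ => hd l, rfl⟩
    rwa [hf] at this
  -- The point mass at `l` is admissible, so `c ≤ F`. Then `F` has mean below `u` under `p` and
  -- above `u` under `q`, against the convex order.
  have h2 : f q ≤ ∑ i, F i * q i := by
    rw [hf]
    refine Finset.sum_le_sum fun l _ => mul_le_mul_of_nonneg_right ?_ (hq l)
    have := hdmax l _ (single_mem_densitiesWithMean x l)
    simpa [Pi.single_apply] using this
  linarith [hpq F hFc]

/-- Jensen's inequality for the two-point density on `a` and `c` with mean `x b`. -/
lemma IsConcaveOnStates.slope_le {F : Fin N → ℝ} (hF : IsConcaveOnStates x F) {a b c : Fin N}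
    (hab : x a < x b) (hbc : x b < x c) :
    (F c - F b) / (x c - x b) ≤ (F b - F a) / (x b - x a) := by
  have hac : 0 < x c - x a := by linarith
  set e : Fin N → Fin N → ℝ := fun l => Pi.single l 1 with he
  have he0 : ∀ l i, 0 ≤ e l i := fun l => (single_mem_densitiesWithMean x l).1
  have hsum : ∀ (G : Fin N → ℝ) l, ∑ i, G i * e l i = G l := fun G l => by
    simp [he, Pi.single_apply]
  set d : Fin N → ℝ := fun i => (x c - x b) / (x c - x a) * e a i
    + (x b - x a) / (x c - x a) * e c i with hd
  have key : ∀ G : Fin N → ℝ, ∑ i, G i * d i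
      = (G a * (x c - x b) + G c * (x b - x a)) / (x c - x a) := fun G => by
    simp only [hd, mul_add, Finset.sum_add_distrib, mul_left_comm (G _), ← Finset.mul_sum, hsum]
    ring
  have h := hF b d ⟨fun i => ?_, ?_, ?_⟩
  · rw [key, div_le_iff₀ hac] at h
    rw [div_le_div_iff₀ (by linarith) (by linarith)]
    linarith
  · exact add_nonneg (mul_nonneg (div_nonneg (by linarith) hac.le) (he0 _ _))
      (mul_nonneg (div_nonneg (by linarith) hac.le) (he0 _ _))
  · have := key fun _ => 1
    simp only [one_mul] at this
    rw [this, div_eq_one_iff_eq hac.ne']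
    ring
  · rw [key, div_eq_iff hac.ne']
    ring

end transition

/-! ### Convex order of the market densities -/

section market

variable {N : ℕ} {K : Fin (N + 1) → ℝ}

lemma callSlope_sub (c c' : Fin (N + 1) → ℝ) (i : Fin (N + 1)) :
    callSlope K (c - c') i = callSlope K c i - callSlope K c' i := by
  induction i using Fin.lastCases with
  | last => simp [callSlope_last]
  | cast i =>
    simp only [callSlope_castSucc, Pi.sub_apply]
    ring

/-- Summation by parts twice: the difference of the summands is the increment of the discrete
Wronskian `φ`, which vanishes at both ends. -/
lemma sum_mul_marketDensity_comm (hK : StrictMono K) {U : Fin (N + 1) → ℝ} (h0 : U 0 = 0)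
    (hN : U (Fin.last N) = 0) (hs : callSlope K U 0 = 0) (f : Fin (N + 1) → ℝ) :
    ∑ i : Fin N, f i.succ * marketDensity K U i = ∑ i : Fin N, marketDensity K f i * U i.succ := by
  set φ : Fin (N + 1) → ℝ := fun i => f i * callSlope K U i - callSlope K f i * U i with hφ
  have key : ∀ i : Fin N, f i.succ * marketDensity K U i - marketDensity K f i * U i.succ
      = φ i.succ - φ i.castSucc := by
    intro i
    have h1 := callSlope_mul_sub (c := f) hK i
    have h2 := callSlope_mul_sub (c := U) hK i
    simp only [hφ, marketDensity]
    linear_combination (callSlope K U i.castSucc) * h1 - (callSlope K f i.castSucc) * h2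
  rw [← sub_eq_zero, ← Finset.sum_sub_distrib, Finset.sum_congr rfl fun i _ => key i,
    Fin.sum_succ_sub_castSucc]
  simp [hφ, h0, hN, hs, callSlope_last]

/-- Calendar monotonicity of call prices means convex order of the market densities. -/
lemma sum_mul_marketDensity_le (hK : StrictMono K) {c c' : Fin (N + 1) → ℝ} (h0 : c 0 = c' 0)
    (hN : c (Fin.last N) = c' (Fin.last N)) (hs : callSlope K c 0 = callSlope K c' 0)
    (hle : ∀ i, c i ≤ c' i) {F : Fin N → ℝ} (hF : IsConcaveOnStates (fun i => K i.succ) F) :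
    ∑ i, F i * marketDensity K c' i ≤ ∑ i, F i * marketDensity K c i := by
  -- The value at strike zero is arbitrary: `f` need not be concave across the first positive
  -- strike, since `c - c'` vanishes there.
  set f : Fin (N + 1) → ℝ := Fin.cons (α := fun _ => ℝ) 0 F with hf
  have hfs : ∀ i : Fin N, f i.succ = F i := fun i => by simp [hf]
  have hs' : callSlope K (c - c') 0 = 0 := by rw [callSlope_sub, hs, sub_self]
  have h := sum_mul_marketDensity_comm hK (U := c - c') (by simp [h0]) (by simp [hN]) hs' f
  have hU : ∀ i, (c - c') i ≤ 0 := fun i => sub_nonpos.2 (hle i)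
  have hpos : 0 ≤ ∑ i : Fin N, marketDensity K f i * (c - c') i.succ := by
    refine Finset.sum_nonneg fun i _ => ?_
    -- Equal prices at strike zero and equal first slopes force equal prices at the first positive
    -- strike.
    by_cases hi0 : i.castSucc = 0
    · have h1 := callSlope_mul_sub (c := c - c') hK i
      rw [hi0, hs', zero_mul] at h1
      have h2 : (c - c') i.succ = 0 := by
        rw [sub_eq_zero.1 h1.symm]; simp [h0]
      rw [h2, mul_zero]
    by_cases hiN : i.succ = Fin.last N
    · rw [hiN]; simp [hN]
    refine mul_nonneg_of_nonpos_of_nonpos ?_ (hU _)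
    obtain ⟨a, ha⟩ := Fin.exists_succ_eq.2 hi0
    obtain ⟨b, hb⟩ := Fin.exists_castSucc_eq.2 hiN
    have h1 := callSlope_castSucc (K := K) (c := f) i
    have h2 := callSlope_castSucc (K := K) (c := f) b
    rw [hb, hfs, hfs] at h2
    rw [← ha, hfs, hfs] at h1
    rw [marketDensity, h2, ← ha, h1, sub_nonpos]
    have hlt1 : K a.succ < K i.succ := ha ▸ hK i.castSucc_lt_succ
    have hlt2 : K i.succ < K b.succ := hb ▸ hK b.castSucc_lt_succ
    exact hF.slope_le (a := a) (b := i) (c := b) hlt1 hlt2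
  rw [← h] at hpos
  have hmd : ∀ i : Fin N, marketDensity K (c - c') i
      = marketDensity K c i - marketDensity K c' i := fun i => by
    simp only [marketDensity, callSlope_sub]; ring
  simp_rw [hmd, hfs, mul_sub, Finset.sum_sub_distrib] at hpos
  linarith

end market

/-! ### Time changes of discrete martingales -/

section timeChange

variable {Ω U : Type*} {mΩ : MeasurableSpace Ω} {mU : MeasurableSpace U}

/-- The filtration of a process run along the clock `n`, which is known at the beginning. -/
def timeChangeFiltration (𝒢 : Filtration ℕ mΩ) (n : ℝ≥0 → U → ℕ)
    (hmono : ∀ u, Monotone fun t => n t u) : Filtration ℝ≥0 (mU.prod mΩ) where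
  seq t :=
    -- The clock variable `u` is known from time zero: an event belongs to time `t` when each of its
    -- sections at fixed `u` is known to `𝒢` at the index `n t u`.
    { MeasurableSet' := fun A =>
        MeasurableSet[mU.prod mΩ] A ∧ ∀ u, MeasurableSet[𝒢 (n t u)] (Prod.mk u ⁻¹' A)
      measurableSet_empty := ⟨@MeasurableSet.empty _ (mU.prod mΩ), fun u => by
        rw [Set.preimage_empty]; exact @MeasurableSet.empty _ (𝒢 (n t u))⟩
      measurableSet_compl := fun A hA => ⟨hA.1.compl, fun u => by
        rw [Set.preimage_compl]; exact (hA.2 u).compl⟩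
      measurableSet_iUnion := fun A hA => ⟨MeasurableSet.iUnion fun i => (hA i).1, fun u => by
        rw [Set.preimage_iUnion]; exact MeasurableSet.iUnion fun i => (hA i).2 u⟩ }
  mono' _ _ hst _ hA := ⟨hA.1, fun u => 𝒢.mono (hmono u hst) _ (hA.2 u)⟩
  le' _ _ hA := hA.1

lemma measurable_timeChange {Y : ℕ → Ω → ℝ} (hY : ∀ i, Measurable (Y i)) {n : U → ℕ}
    (hn : Measurable n) : Measurable fun z : U × Ω => Y (n z.1) z.2 := by
  have h : Measurable fun p : ℕ × Ω => Y p.1 p.2 :=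
    measurable_from_prod_countable_right fun i => hY i
  exact h.comp ((hn.comp measurable_fst).prodMk measurable_snd)

lemma integrable_timeChange {P : Measure Ω} {Q : Measure U} [IsProbabilityMeasure P]
    [IsProbabilityMeasure Q] {Y : ℕ → Ω → ℝ} (hY : ∀ i, Measurable (Y i))
    (hint : ∀ i, Integrable (Y i) P) {n : U → ℕ} (hn : Measurable n) {M : ℕ} (hM : ∀ u, n u ≤ M) :
    Integrable (fun z : U × Ω => Y (n z.1) z.2) (Q.prod P) := by
  have hsum : Integrable (fun z : U × Ω => ∑ i ∈ Finset.range (M + 1), ‖Y i z.2‖) (Q.prod P) :=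
    (integrable_finsetSum _ fun i _ => (hint i).norm).comp_snd Q
  refine hsum.mono' (measurable_timeChange hY hn).aestronglyMeasurable (ae_of_all _ fun z => ?_)
  exact Finset.single_le_sum (f := fun i => ‖Y i z.2‖) (fun i _ => norm_nonneg _)
    (Finset.mem_range.2 (Nat.lt_succ_of_le (hM z.1)))

/-- The clock is independent of `Y`, so no stopping argument is needed. By Fubini the identity is
checked for each fixed `u`, where the clock is deterministic and the section of the event lies in `𝒢
(n s u)`. -/
theorem MeasureTheory.Martingale.timeChange {P : Measure Ω} {Q : Measure U} [IsProbabilityMeasure P]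
    [IsProbabilityMeasure Q] {𝒢 : Filtration ℕ mΩ} {Y : ℕ → Ω → ℝ} (hY : Martingale Y 𝒢 P)
    {n : ℝ≥0 → U → ℕ} (hmono : ∀ u, Monotone fun t => n t u) (hn : ∀ t, Measurable (n t))
    {M : ℕ} (hM : ∀ t u, n t u ≤ M) :
    Martingale (fun t (z : U × Ω) => Y (n t z.1) z.2) (timeChangeFiltration 𝒢 n hmono)
      (Q.prod P) := by
  have hYm : ∀ i, Measurable (Y i) := fun i => ((hY.1 i).mono (𝒢.le i)).measurable
  have hint : ∀ t, Integrable (fun z : U × Ω => Y (n t z.1) z.2) (Q.prod P) := fun t =>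
    integrable_timeChange hYm hY.integrable (hn t) (hM t)
  have hadp : StronglyAdapted (timeChangeFiltration 𝒢 n hmono)
      fun t (z : U × Ω) => Y (n t z.1) z.2 := fun t => by
    refine Measurable.stronglyMeasurable fun s hs => ⟨measurable_timeChange hYm (hn t) hs,
      fun u => ?_⟩
    exact (hY.1 (n t u)).measurable hs
  refine ⟨hadp, fun s t hst => (ae_eq_condExp_of_forall_setIntegral_eq
    ((timeChangeFiltration 𝒢 n hmono).le s) (hint t) (fun _ _ _ => (hint s).integrableOn)
    (fun A hA _ => ?_) (hadp s).aestronglyMeasurable).symm⟩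
  rw [← integral_indicator hA.1, ← integral_indicator hA.1, integral_prod _
    ((hint s).indicator hA.1), integral_prod _ ((hint t).indicator hA.1)]
  congr 1 with u
  have hsec : ∀ r, ∫ w, A.indicator (fun z : U × Ω => Y (n r z.1) z.2) (u, w) ∂P
      = ∫ w in Prod.mk u ⁻¹' A, Y (n r u) w ∂P := fun r => by
    rw [← integral_indicator (measurable_prodMk_left hA.1)]
    rfl
  rw [hsec, hsec]
  exact hY.setIntegral_eq (hmono u hst) (hA.2 u)

end timeChange

/-! ### Martingales from Markov chains -/

/-- The path measure comes from the Ionescu-Tulcea theorem, with kernels that see only the last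
coordinate of the past. The marginals follow by induction from `hμ`, and the martingale property
from the one-step identity `hmart`, integrated over events in the first coordinates. -/
theorem exists_martingale_of_markovChain {E : Type*} [MeasurableSpace E] (μ : ℕ → Measure E)
    [∀ n, IsProbabilityMeasure (μ n)] (κ : ℕ → Kernel E E) [∀ n, IsMarkovKernel (κ n)]
    (hμ : ∀ n, κ n ∘ₘ μ n = μ (n + 1)) (y : ℕ → E → ℝ) (hy : ∀ n, Measurable (y n))
    (hint : ∀ n, Integrable (y n) (μ n)) (hmart : ∀ n e, ∫ e', y (n + 1) e' ∂(κ n e) = y n e) :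
    ∃ P : Measure (ℕ → E), IsProbabilityMeasure P ∧ (∀ n, P.map (fun w => w n) = μ n) ∧
      Martingale (fun n w => y n (w n)) Filtration.piLE P := by
  let last : ∀ n : ℕ, (Finset.Iic n → E) → E := fun n w => w ⟨n, Finset.mem_Iic.2 le_rfl⟩
  have hlast : ∀ n, Measurable (last n) := fun n => measurable_pi_apply _
  let η : ∀ n : ℕ, Kernel (Finset.Iic n → E) E := fun n => (κ n).comap (last n) (hlast n)
  have hη : ∀ n w, η n w = κ n (last n w) := fun n w => rfl
  let P : Measure (ℕ → E) := Kernel.trajMeasure (X := fun _ : ℕ => E) (μ 0) η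
  have hP : IsProbabilityMeasure P :=
    inferInstanceAs (IsProbabilityMeasure (Kernel.trajMeasure (X := fun _ : ℕ => E) (μ 0) η))
  have hfr : ∀ n, Measurable (Preorder.frestrictLe (π := fun _ : ℕ => E) n) := fun n =>
    Preorder.measurable_frestrictLe (X := fun _ : ℕ => E) n
  have hstep : ∀ n, (P.map (Preorder.frestrictLe (π := fun _ : ℕ => E) n)) ⊗ₘ η n
      = P.map (fun w => (Preorder.frestrictLe (π := fun _ : ℕ => E) n w, w (n + 1))) := fun n =>
    Kernel.map_frestrictLe_trajMeasure_compProd_eq_map_trajMeasure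
  have hlaw : ∀ n, P.map (fun w => w n) = μ n := by
    intro n
    induction n with
    | zero =>
      have h1 : P.map (Preorder.frestrictLe (π := fun _ : ℕ => E) 0)
          = (μ 0).map (MeasurableEquiv.piUnique fun _ : Finset.Iic 0 => E).symm := by
        simp only [P, Kernel.trajMeasure]
        rw [Measure.map_comp _ _ (hfr 0), Kernel.traj_map_frestrictLe, Kernel.partialTraj_self,
          Measure.id_comp]
      have h2 : (fun w : ℕ → E => w 0) = last 0 ∘ Preorder.frestrictLe (π := fun _ : ℕ => E) 0 := rfl
      rw [h2, ← Measure.map_map (hlast 0) (hfr 0), h1, Measure.map_map (hlast 0)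
        (MeasurableEquiv.measurable _)]
      convert! Measure.map_id
    | succ n ih =>
      have h2 : (fun w : ℕ → E => w (n + 1))
          = Prod.snd ∘ fun w => (Preorder.frestrictLe (π := fun _ : ℕ => E) n w, w (n + 1)) := rfl
      rw [h2, ← Measure.map_map measurable_snd ((hfr n).prodMk (measurable_pi_apply _)), ← hstep,
        ← Measure.snd, Measure.snd_compProd, ← hμ, ← ih]
      have h3 : (fun w : ℕ → E => w n) = last n ∘ Preorder.frestrictLe (π := fun _ : ℕ => E) n := rfl
      have h4 : η n = κ n ∘ₖ Kernel.deterministic (last n) (hlast n) :=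
        (Kernel.comp_deterministic_eq_comap _ _).symm
      rw [h3, ← Measure.map_map (hlast n) (hfr n), h4, ← Measure.comp_assoc,
        Measure.deterministic_comp_eq_map]
  have hYint : ∀ n, Integrable (fun w : ℕ → E => y n (w n)) P := fun n => by
    have h := hint n
    rw [← hlaw n] at h
    exact h.comp_measurable (measurable_pi_apply n)
  refine ⟨P, hP, hlaw, martingale_of_setIntegral_eq_succ (fun n => ?_) hYint fun n A hA => ?_⟩
  · rw [Filtration.piLE_eq_comap_frestrictLe]
    have h3 : (fun w : ℕ → E => y n (w n))
        = (y n ∘ last n) ∘ Preorder.frestrictLe (π := fun _ : ℕ => E) n := rfl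
    rw [h3]
    exact (((hy n).comp (hlast n)).comp (comap_measurable _)).stronglyMeasurable
  · rw [Filtration.piLE_eq_comap_frestrictLe] at hA
    obtain ⟨B, hB, rfl⟩ := hA
    have hpair : Measurable fun w : ℕ → E =>
        (Preorder.frestrictLe (π := fun _ : ℕ => E) n w, w (n + 1)) :=
      (hfr n).prodMk (measurable_pi_apply _)
    have hym : Measurable fun p : (Finset.Iic n → E) × E => y (n + 1) p.2 :=
      (hy _).comp measurable_snd
    have hyl : Measurable fun w => y n (last n w) := (hy n).comp (hlast n)
    have hint' : Integrable (fun p : (Finset.Iic n → E) × E => y (n + 1) p.2)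
        (P.map (Preorder.frestrictLe (π := fun _ : ℕ => E) n) ⊗ₘ η n) := by
      rw [hstep, integrable_map_measure hym.aestronglyMeasurable hpair.aemeasurable]
      exact hYint (n + 1)
    have h1 := Measure.setIntegral_compProd hB MeasurableSet.univ hint'.integrableOn
    rw [hstep, setIntegral_map (hB.prod MeasurableSet.univ)
      hym.aestronglyMeasurable hpair.aemeasurable] at h1
    simp only [Measure.restrict_univ, hη, hmart] at h1
    rw [setIntegral_map hB hyl.aestronglyMeasurable (hfr n).aemeasurable] at h1
    have h2 : (fun w : ℕ → E => (Preorder.frestrictLe (π := fun _ : ℕ => E) n w, w (n + 1))) ⁻¹'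
        (B ×ˢ Set.univ) = Preorder.frestrictLe n ⁻¹' B := by ext w; simp
    rw [h2] at h1
    exact h1.symm

/-! ### A martingale with prescribed model prices -/

section chain

variable {N : ℕ}

/-- The measure on the states with density `q`. -/
noncomputable def stateMeasure (q : Fin N → ℝ) : Measure (Fin N) :=
  ∑ i, ENNReal.ofReal (q i) • Measure.dirac i

instance (q : Fin N → ℝ) : IsFiniteMeasure (stateMeasure q) := by
  refine ⟨?_⟩
  simp [stateMeasure, Measure.coe_finsetSum, Finset.sum_apply, ENNReal.sum_lt_top]

lemma isProbabilityMeasure_stateMeasure {q : Fin N → ℝ} (hq : ∀ i, 0 ≤ q i)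
    (h1 : ∑ i, q i = 1) : IsProbabilityMeasure (stateMeasure q) := by
  refine ⟨?_⟩
  simp only [stateMeasure, Measure.coe_finsetSum, Finset.sum_apply, Measure.smul_apply,
    measure_univ, smul_eq_mul, mul_one]
  rw [← ENNReal.ofReal_sum_of_nonneg fun i _ => hq i, h1, ENNReal.ofReal_one]

lemma integral_stateMeasure {q : Fin N → ℝ} (hq : ∀ i, 0 ≤ q i) (f : Fin N → ℝ) :
    ∫ i, f i ∂(stateMeasure q) = ∑ i, q i * f i := by
  have hfin : ∀ i : Fin N, IsFiniteMeasure (ENNReal.ofReal (q i) • Measure.dirac i) := fun i =>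
    Measure.smul_finite _ ENNReal.ofReal_ne_top
  rw [stateMeasure, integral_finsetSum_measure fun i _ => Integrable.of_finite]
  simp [hq]

/-- The transition kernel with matrix `P`. -/
noncomputable def stateKernel (P : Matrix (Fin N) (Fin N) ℝ) : Kernel (Fin N) (Fin N) :=
  Kernel.ofFunOfCountable fun l => stateMeasure fun i => P i l

lemma stateKernel_apply (P : Matrix (Fin N) (Fin N) ℝ) (l : Fin N) :
    stateKernel P l = stateMeasure fun i => P i l := rfl

lemma isMarkovKernel_stateKernel {x : Fin N → ℝ} {P : Matrix (Fin N) (Fin N) ℝ}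
    (hP : IsMartingaleTransition x P) : IsMarkovKernel (stateKernel P) :=
  ⟨fun l => isProbabilityMeasure_stateMeasure (fun i => hP.nonneg i l) (hP.col_sum l)⟩

lemma stateKernel_comp_stateMeasure {x q : Fin N → ℝ} {P : Matrix (Fin N) (Fin N) ℝ}
    (hP : IsMartingaleTransition x P) (hq : ∀ i, 0 ≤ q i) :
    stateKernel P ∘ₘ stateMeasure q = stateMeasure (P.mulVec q) := by
  ext s hs
  rw [Measure.bind_apply hs (Kernel.aemeasurable _)]
  have hsum : ∀ (r : Fin N → ℝ), stateMeasure r s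
      = ∑ i, ENNReal.ofReal (r i) * s.indicator 1 i := fun r => by
    simp [stateMeasure, Measure.coe_finsetSum, Finset.sum_apply, Measure.dirac_apply' _ hs]
  simp_rw [stateKernel_apply, hsum]
  rw [stateMeasure, lintegral_finsetSum_measure]
  simp_rw [lintegral_smul_measure, lintegral_dirac, smul_eq_mul, Matrix.mulVec, dotProduct]
  simp_rw [Finset.mul_sum]
  rw [Finset.sum_comm]
  refine Finset.sum_congr rfl fun i _ => ?_
  rw [ENNReal.ofReal_sum_of_nonneg fun l _ => mul_nonneg (hP.nonneg i l) (hq l), Finset.sum_mul]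
  refine Finset.sum_congr rfl fun l _ => ?_
  rw [ENNReal.ofReal_mul (hP.nonneg i l)]
  ring

/-- The kernel that adds an independent centred Gaussian variable. -/
noncomputable def gaussianKernel (δ : ℝ≥0) : Kernel ℝ ℝ where
  toFun w := gaussianReal w δ
  measurable' := measurable_gaussianReal.comp (measurable_id.prodMk measurable_const)

lemma gaussianKernel_apply (δ : ℝ≥0) (w : ℝ) : gaussianKernel δ w = gaussianReal w δ := rfl

instance (δ : ℝ≥0) : IsMarkovKernel (gaussianKernel δ) :=
  ⟨fun w => inferInstanceAs (IsProbabilityMeasure (gaussianReal w δ))⟩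

lemma gaussianKernel_comp_gaussianReal (v δ : ℝ≥0) :
    gaussianKernel δ ∘ₘ gaussianReal 0 v = gaussianReal 0 (v + δ) := by
  have hconv := gaussianReal_conv_gaussianReal (m₁ := 0) (m₂ := 0) (v₁ := v) (v₂ := δ)
  rw [add_zero] at hconv
  refine Measure.ext_of_lintegral _ fun f hf => ?_
  rw [Measure.lintegral_bind (Kernel.aemeasurable _) hf.aemeasurable, ← hconv,
    Measure.lintegral_conv hf]
  refine lintegral_congr fun w => ?_
  have h := gaussianReal_map_const_add (μ := 0) (v := δ) w
  rw [zero_add] at h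
  rw [gaussianKernel_apply, ← h, lintegral_map hf (by fun_prop)]

lemma parallelComp_comp_prod_measure {α β γ δ : Type*} [MeasurableSpace α] [MeasurableSpace β]
    [MeasurableSpace γ] [MeasurableSpace δ] (κ : Kernel α β) [IsSFiniteKernel κ] (η : Kernel γ δ)
    [IsSFiniteKernel η] (μ : Measure α) [SFinite μ] (ν : Measure γ) [SFinite ν] :
    (κ ∥ₖ η) ∘ₘ (μ.prod ν) = (κ ∘ₘ μ).prod (η ∘ₘ ν) := by
  rw [Measure.prod_comp_left, Measure.prod_comp_right, Measure.comp_assoc,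
    Kernel.parallelComp_id_right_comp_parallelComp, Kernel.comp_id]

lemma integrable_mul_exp (x q : Fin N → ℝ) (v : ℝ≥0) :
    Integrable (fun z : Fin N × ℝ => x z.1 * Real.exp (z.2 - v / 2))
      ((stateMeasure q).prod (gaussianReal 0 v)) :=
  (Integrable.of_finite (f := x)).mul_prod (integrable_exp_gaussianReal v)

lemma integral_payoff_eq_smoothCall {x q : Fin N → ℝ} (hx : ∀ i, 0 < x i) (hq : ∀ i, 0 ≤ q i)
    (v : ℝ≥0) {k : ℝ} (hk : 0 ≤ k) :
    ∫ z, max (x z.1 * Real.exp (z.2 - v / 2) - k) 0 ∂((stateMeasure q).prod (gaussianReal 0 v))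
      = smoothCall x q v k := by
  have hint : Integrable (fun z : Fin N × ℝ => max (x z.1 * Real.exp (z.2 - v / 2) - k) 0)
      ((stateMeasure q).prod (gaussianReal 0 v)) :=
    ((integrable_mul_exp x q v).sub (integrable_const k)).sup (integrable_const 0)
  rw [integral_prod _ hint, integral_stateMeasure hq, smoothCall]
  exact Finset.sum_congr rfl fun i _ => by rw [bsCall_eq_integral (hx i) hk]

/-- State and Gaussian part move independently: the state keeps its mean by the column condition,
and the new exponential factor has mean one. -/
lemma integral_step {x : Fin N → ℝ} {P : Matrix (Fin N) (Fin N) ℝ}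
    (hP : IsMartingaleTransition x P) (v δ : ℝ≥0) (l : Fin N) (w : ℝ) :
    ∫ z, x z.1 * Real.exp (z.2 - (v + δ : ℝ≥0) / 2) ∂((stateKernel P ∥ₖ gaussianKernel δ) (l, w))
      = x l * Real.exp (w - v / 2) := by
  have := isMarkovKernel_stateKernel hP
  rw [Kernel.parallelComp_apply, integral_prod_mul x fun y => Real.exp (y - (v + δ : ℝ≥0) / 2),
    stateKernel_apply, integral_stateMeasure fun i => hP.nonneg i l]
  simp_rw [mul_comm (P _ l)]
  rw [hP.col_mean, gaussianKernel_apply, ← integral_gaussianReal_comp_add _ _ _ (by fun_prop)]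
  have h : ∀ y : ℝ, Real.exp (w + y - (v + δ : ℝ≥0) / 2)
      = Real.exp (w - v / 2) * Real.exp (y - δ / 2) := fun y => by
    rw [← Real.exp_add, NNReal.coe_add]
    congr 1
    ring
  simp_rw [h]
  rw [integral_const_mul, integral_exp_gaussianReal, mul_one]

/-- A positive martingale, started at one, whose call prices are the model prices. -/
theorem exists_martingale_smoothCall {x : Fin N → ℝ} (hx : ∀ i, 0 < x i) (q : ℕ → Fin N → ℝ)
    (hq : ∀ n i, 0 ≤ q n i) (hq1 : ∀ n, ∑ i, q n i = 1) (hmean : ∑ i, x i * q 0 i = 1)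
    (P : ℕ → Matrix (Fin N) (Fin N) ℝ) (hP : ∀ n, IsMartingaleTransition x (P n))
    (hPq : ∀ n, q (n + 1) = (P n).mulVec (q n)) (V : ℕ → ℝ≥0) (hV : Monotone V) :
    ∃ (Ω : Type) (mΩ : MeasurableSpace Ω) (ρ : Measure Ω) (_ : IsProbabilityMeasure ρ)
      (𝒢 : Filtration ℕ mΩ) (Y : ℕ → Ω → ℝ), Martingale Y 𝒢 ρ ∧ (∀ n w, 0 < Y n w) ∧
      (∀ w, Y 0 w = 1) ∧
      ∀ n k, 0 ≤ k → ∫ w, max (Y (n + 1) w - k) 0 ∂ρ = smoothCall x (q n) (V n) k := by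
  have hN : Nonempty (Fin N) := by
    by_contra h
    rw [not_nonempty_iff] at h
    simpa using hq1 0
  obtain ⟨i₀⟩ := hN
  have hprob : ∀ n, IsProbabilityMeasure (stateMeasure (q n)) := fun n =>
    isProbabilityMeasure_stateMeasure (hq n) (hq1 n)
  have hmk : ∀ n, IsMarkovKernel (stateKernel (P n)) := fun n => isMarkovKernel_stateKernel (hP n)
  let ν : ℕ → Measure (Fin N × ℝ) := fun n => (stateMeasure (q n)).prod (gaussianReal 0 (V n))
  -- The chain index is shifted by one: index `n + 1` carries the law for `q n`, while index `0` is
  -- a dummy state at which the process equals 1. The first kernel therefore ignores its argument.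
  let μ : ℕ → Measure (Fin N × ℝ) := fun
    | 0 => Measure.dirac (i₀, 0)
    | n + 1 => ν n
  let κ : ℕ → Kernel (Fin N × ℝ) (Fin N × ℝ) := fun
    | 0 => Kernel.const _ (ν 0)
    | n + 1 => stateKernel (P n) ∥ₖ gaussianKernel (V (n + 1) - V n)
  let y : ℕ → Fin N × ℝ → ℝ := fun
    | 0 => fun _ => 1
    | n + 1 => fun z => x z.1 * Real.exp (z.2 - V n / 2)
  have hVadd : ∀ n, V n + (V (n + 1) - V n) = V (n + 1) := fun n =>
    add_tsub_cancel_of_le (hV n.le_succ)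
  have hμp : ∀ n, IsProbabilityMeasure (μ n) := by
    rintro (_ | n)
    · exact inferInstanceAs (IsProbabilityMeasure (Measure.dirac (i₀, (0 : ℝ))))
    · exact inferInstanceAs
        (IsProbabilityMeasure ((stateMeasure (q n)).prod (gaussianReal 0 (V n))))
  have hκ : ∀ n, IsMarkovKernel (κ n) := by
    rintro (_ | n)
    · have : IsProbabilityMeasure (ν 0) := hμp 1
      exact inferInstanceAs (IsMarkovKernel (Kernel.const _ (ν 0)))
    · exact inferInstanceAs
        (IsMarkovKernel (stateKernel (P n) ∥ₖ gaussianKernel (V (n + 1) - V n)))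
  have hμ : ∀ n, κ n ∘ₘ μ n = μ (n + 1) := by
    rintro (_ | n)
    · have := hμp 0
      change Kernel.const _ (ν 0) ∘ₘ μ 0 = ν 0
      rw [Measure.const_comp, (hμp 0).measure_univ, one_smul]
    · change (stateKernel (P n) ∥ₖ gaussianKernel (V (n + 1) - V n)) ∘ₘ
        ((stateMeasure (q n)).prod (gaussianReal 0 (V n)))
        = (stateMeasure (q (n + 1))).prod (gaussianReal 0 (V (n + 1)))
      rw [parallelComp_comp_prod_measure, stateKernel_comp_stateMeasure (hP n) (hq n), ← hPq,
        gaussianKernel_comp_gaussianReal, hVadd]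
  have hy : ∀ n, Measurable (y n) := by
    rintro (_ | n)
    · exact measurable_const
    · exact ((measurable_of_finite x).comp measurable_fst).mul (by fun_prop)
  have hint : ∀ n, Integrable (y n) (μ n) := by
    rintro (_ | n)
    · exact integrable_const (μ := Measure.dirac (i₀, (0 : ℝ))) (1 : ℝ)
    · exact integrable_mul_exp x (q n) (V n)
  have hmart : ∀ n e, ∫ e', y (n + 1) e' ∂(κ n e) = y n e := by
    rintro (_ | n) ⟨l, w⟩
    · change ∫ z, x z.1 * Real.exp (z.2 - V 0 / 2)
        ∂((stateMeasure (q 0)).prod (gaussianReal 0 (V 0))) = 1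
      rw [integral_prod_mul x fun y => Real.exp (y - V 0 / 2), integral_stateMeasure (hq 0),
        integral_exp_gaussianReal, mul_one, ← hmean]
      simp_rw [mul_comm]
    · have h := integral_step (hP n) (V n) (V (n + 1) - V n) l w
      rw [hVadd] at h
      exact h
  obtain ⟨ρ, hρ, hlaw, hY⟩ := exists_martingale_of_markovChain μ κ hμ y hy hint hmart
  refine ⟨ℕ → Fin N × ℝ, inferInstance, ρ, hρ, _, _, hY, ?_, fun _ => rfl, fun n k hk => ?_⟩
  · rintro (_ | n) w
    · exact one_pos
    · exact mul_pos (hx _) (Real.exp_pos _)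
  · rw [← integral_payoff_eq_smoothCall hx (hq n) (V n) hk]
    have h := hlaw (n + 1)
    change _ = ν n at h
    change _ = ∫ z, _ ∂(ν n)
    rw [← h, integral_map (measurable_pi_apply _).aemeasurable]
    exact (((hy (n + 1)).sub_const k).max measurable_const).aestronglyMeasurable

end chain

/-! ### Interpolation in time -/

section timeInterp

variable {M : ℕ} {τ : Fin (M + 1) → ℝ} {α : Fin M → ℝ → ℝ}

lemma exists_mem_period (hτ0 : τ 0 = 0) {t : ℝ} (ht : 0 ≤ t) (htM : t < τ (Fin.last M)) :
    ∃ m : Fin M, τ m.castSucc ≤ t ∧ t < τ m.succ := by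
  have h : ∀ i : Fin (M + 1), t < τ i → ∃ m : Fin M, τ m.castSucc ≤ t ∧ t < τ m.succ := by
    intro i
    induction i using Fin.induction with
    | zero => exact fun h => absurd (hτ0 ▸ h) ht.not_gt
    | succ i ih =>
      intro h
      rcases le_or_gt (τ i.castSucc) t with h1 | h1
      · exact ⟨i, h1, h⟩
      · exact ih h1
  exact h _ htM

lemma eq_of_mem_period (hτ : StrictMono τ) {t : ℝ} {j m : Fin M}
    (hj : τ j.castSucc ≤ t ∧ t < τ j.succ) (hm : τ m.castSucc ≤ t ∧ t < τ m.succ) : j = m := by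
  have h1 := hτ.lt_iff_lt.1 (hj.1.trans_lt hm.2)
  have h2 := hτ.lt_iff_lt.1 (hm.1.trans_lt hj.2)
  simp only [Fin.lt_def, Fin.val_castSucc, Fin.val_succ] at h1 h2
  ext
  omega

lemma timeInterp_of_mem_period (hτ : StrictMono τ) (c : Fin M → ℝ → ℝ) {t : ℝ} {m : Fin M}
    (h1 : τ m.castSucc ≤ t) (h2 : t < τ m.succ) (k : ℝ) :
    timeInterp τ α c t k = α m t * slices c m.succ k + (1 - α m t) * slices c m.castSucc k := by
  have hlast : ¬τ (Fin.last M) ≤ t :=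
    (h2.trans_le (hτ.monotone (Fin.le_last _))).not_ge
  rw [timeInterp, if_neg hlast, Finset.sum_eq_single m, if_pos ⟨h1, h2⟩]
  · intro j _ hj
    exact if_neg fun h => hj (eq_of_mem_period hτ h ⟨h1, h2⟩)
  · simp

lemma IsTimeInterp.mem_Icc (hα : IsTimeInterp τ α) {m : Fin M} {t : ℝ}
    (h1 : τ m.castSucc ≤ t) (h2 : t ≤ τ m.succ) : α m t ∈ Set.Icc (0 : ℝ) 1 :=
  ⟨hα.left m ▸ hα.mono m ⟨le_rfl, h1.trans h2⟩ ⟨h1, h2⟩ h1,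
    hα.right m ▸ hα.mono m ⟨h1, h2⟩ ⟨h1.trans h2, le_rfl⟩ h2⟩

open Classical in
/-- The number of expiries that are passed at time `t`, where the `j`-th expiry is passed as soon
as the weight `α j` exceeds the level `u`. -/
noncomputable def clock (τ : Fin (M + 1) → ℝ) (α : Fin M → ℝ → ℝ) (t : ℝ≥0) (u : unitInterval) :
    ℕ :=
  (Finset.univ.filter fun j : Fin M =>
    τ j.succ ≤ t ∨ (τ j.castSucc ≤ t ∧ (u : ℝ) < α j t)).card

lemma clock_le (t : ℝ≥0) (u : unitInterval) : clock τ α t u ≤ M :=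
  (Finset.card_filter_le _ _).trans_eq (by simp)

lemma clock_monotone (hα : IsTimeInterp τ α) (u : unitInterval) :
    Monotone fun t => clock τ α t u := by
  intro s t hst
  refine Finset.card_le_card fun j hj => ?_
  have hst' : (s : ℝ) ≤ t := hst
  simp only [Finset.mem_filter, Finset.mem_univ, true_and] at hj ⊢
  rcases le_or_gt (τ j.succ) t with ht | ht
  · exact Or.inl ht
  rcases hj with hj | ⟨h1, h2⟩
  · exact Or.inl (hj.trans hst')
  · exact Or.inr ⟨h1.trans hst', h2.trans_le (hα.mono j ⟨h1, hst'.trans ht.le⟩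
      ⟨h1.trans hst', ht.le⟩ hst')⟩

lemma measurable_clock (t : ℝ≥0) : Measurable (clock τ α t) := by
  classical
  unfold clock
  simp only [Finset.card_filter]
  refine Finset.measurable_sum _ fun j _ => Measurable.ite ?_ measurable_const measurable_const
  exact (MeasurableSet.const _).union ((MeasurableSet.const _).inter
    (measurableSet_lt measurable_subtype_coe measurable_const))

lemma clock_of_last_le (hτ : StrictMono τ) {t : ℝ≥0} (ht : τ (Fin.last M) ≤ t)
    (u : unitInterval) : clock τ α t u = M := by
  rw [clock, Finset.filter_true_of_mem fun j _ =>
    Or.inl ((hτ.monotone (Fin.le_last _)).trans ht)]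
  simp

lemma clock_of_mem_period (hτ : StrictMono τ) {t : ℝ≥0} {m : Fin M}
    (h1 : τ m.castSucc ≤ t) (h2 : t < τ m.succ) (u : unitInterval) :
    clock τ α t u = if (u : ℝ) < α m t then (m : ℕ) + 1 else m := by
  classical
  have hlt : ∀ j : Fin M, j < m → τ j.succ ≤ t := fun j hj =>
    (hτ.monotone (Fin.succ_le_castSucc_iff.2 hj)).trans h1
  have hout : ∀ j : Fin M, m < j → t < τ j.castSucc ∧ t < τ j.succ := fun j hj => by
    have h := h2.trans_le (hτ.monotone (Fin.succ_le_castSucc_iff.2 hj))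
    exact ⟨h, h.trans (hτ j.castSucc_lt_succ)⟩
  split_ifs with hu
  · rw [← Fin.card_Iic, clock]
    congr 1
    ext j
    simp only [Finset.mem_filter, Finset.mem_univ, true_and, Finset.mem_Iic]
    rcases lt_trichotomy j m with hj | rfl | hj
    · simp [hj.le, hlt j hj]
    · simp [h1, hu]
    · exact iff_of_false (not_or.2 ⟨(hout j hj).2.not_ge, fun h => (hout j hj).1.not_ge h.1⟩)
        hj.not_ge
  · rw [← Fin.card_Iio, clock]
    congr 1
    ext j
    simp only [Finset.mem_filter, Finset.mem_univ, true_and, Finset.mem_Iio]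
    rcases lt_trichotomy j m with hj | rfl | hj
    · simp [hj, hlt j hj]
    · simp [h2, not_lt.1 hu]
    · exact iff_of_false (not_or.2 ⟨(hout j hj).2.not_ge, fun h => (hout j hj).1.not_ge h.1⟩)
        hj.not_gt

lemma integral_ite_lt_unitInterval {a : ℝ} (ha : a ∈ Set.Icc (0 : ℝ) 1) (b c : ℝ) :
    ∫ u : unitInterval, (if (u : ℝ) < a then b else c) = a * b + (1 - a) * c := by
  have h : ∀ u : unitInterval, (if (u : ℝ) < a then b else c)
      = (Set.Iio (⟨a, ha⟩ : unitInterval)).indicator (fun _ => b - c) u + c := fun u => by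
    by_cases hu : (u : ℝ) < a
    · rw [if_pos hu, Set.indicator_of_mem (show u ∈ Set.Iio (⟨a, ha⟩ : unitInterval) from hu)]
      ring
    · rw [if_neg hu, Set.indicator_of_notMem (show u ∉ Set.Iio (⟨a, ha⟩ : unitInterval) from hu)]
      ring
  simp_rw [h]
  rw [integral_add ((integrable_const _).indicator measurableSet_Iio) (integrable_const _),
    integral_indicator_const _ measurableSet_Iio, measureReal_def, unitInterval.volume_Iio]
  simp [ENNReal.toReal_ofReal ha.1]
  ring

/-- If the slices are the call prices of a positive discrete martingale, then their interpolation
in time is an arbitrage-free surface. -/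
theorem isArbitrageFreeSurface_timeInterp (hτ : StrictMono τ) (hτ0 : τ 0 = 0)
    (hα : IsTimeInterp τ α) {c : Fin M → ℝ → ℝ} {Ω : Type} {mΩ : MeasurableSpace Ω}
    {ρ : Measure Ω} [IsProbabilityMeasure ρ] {𝒢 : Filtration ℕ mΩ} {Y : ℕ → Ω → ℝ}
    (hY : Martingale Y 𝒢 ρ) (hpos : ∀ n w, 0 < Y n w) (hone : ∀ w, Y 0 w = 1)
    (hc : ∀ (n : Fin (M + 1)) (k : ℝ), 0 ≤ k → ∫ w, max (Y n w - k) 0 ∂ρ = slices c n k) :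
    IsArbitrageFreeSurface (timeInterp τ α c) := by
  refine ⟨unitInterval × Ω, inferInstance, volume.prod ρ, inferInstance,
    timeChangeFiltration 𝒢 (clock τ α) (clock_monotone hα),
    fun t z => Y (clock τ α t z.1) z.2,
    hY.timeChange (clock_monotone hα) measurable_clock clock_le,
    fun t => ae_of_all _ fun z => hpos _ _, ae_of_all _ fun z => ?_, fun t k => ?_⟩
  · have h0 : clock τ α 0 z.1 = 0 := by
      -- The first alternative occurs only for `M = 0`.
      rcases le_or_gt (τ (Fin.last M)) ((0 : ℝ≥0) : ℝ) with h | h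
      · rw [clock_of_last_le hτ h]
        rw [NNReal.coe_zero, ← hτ0, hτ.le_iff_le, Fin.le_zero_iff] at h
        simpa using congrArg Fin.val h
      · obtain ⟨m, h1, h2⟩ := exists_mem_period hτ0 (NNReal.coe_nonneg 0) h
        have hm : m.castSucc = 0 := by
          rw [NNReal.coe_zero, ← hτ0, hτ.le_iff_le, Fin.le_zero_iff] at h1
          exact h1
        have hα0 : α m ((0 : ℝ≥0) : ℝ) = 0 := by
          have hl := hα.left m
          rwa [hm, hτ0] at hl
        rw [clock_of_mem_period hτ h1 h2, hα0, if_neg z.1.2.1.not_gt]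
        simpa using congrArg Fin.val hm
    simp only [h0, hone]
  · have hYm : ∀ i, Measurable (Y i) := fun i => ((hY.1 i).mono (𝒢.le i)).measurable
    have hint := integrable_timeChange (P := ρ) (Q := (volume : Measure unitInterval))
      (Y := fun i w => max (Y i w - k) 0) (fun i => ((hYm i).sub_const _).max measurable_const)
      (fun i => ((hY.integrable i).sub (integrable_const _)).sup (integrable_const 0))
      (measurable_clock (τ := τ) (α := α) t) (clock_le t)
    rw [integral_prod _ hint]
    rcases le_or_gt (τ (Fin.last M)) t with h | h
    · simp only [clock_of_last_le hτ h]
      rw [timeInterp, if_pos h, integral_const, probReal_univ, one_smul, ← hc _ _ k.coe_nonneg]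
      rfl
    · obtain ⟨m, h1, h2⟩ := exists_mem_period hτ0 t.coe_nonneg h
      -- In this period the clock is `m + 1` for `u < α m t` and `m` otherwise, so the interpolation
      -- weights are the probabilities of the two values.
      rw [timeInterp_of_mem_period hτ c h1 h2, ← integral_ite_lt_unitInterval
        (hα.mem_Icc h1 h2.le)]
      congr 1 with u
      simp only [clock_of_mem_period hτ h1 h2]
      split_ifs
      · rw [← hc _ _ k.coe_nonneg]; rfl
      · rw [← hc _ _ k.coe_nonneg]; rfl

lemma hasDerivWithinAt_payoff (k : ℝ) :
    HasDerivWithinAt (fun k : ℝ => max (1 - k) 0) (if k < 1 then -1 else 0) (Set.Ioi k) k := by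
  split_ifs with hk
  · refine (HasDerivAt.congr_of_eventuallyEq ((hasDerivAt_id k).const_sub 1)
      ?_).hasDerivWithinAt
    filter_upwards [Iio_mem_nhds hk] with y hy
    exact max_eq_left (sub_nonneg.2 (le_of_lt hy))
  · rw [not_lt] at hk
    refine (hasDerivWithinAt_const k _ (0 : ℝ)).congr (fun y hy => ?_) ?_
    · exact max_eq_right (sub_nonpos.2 (hk.trans (le_of_lt hy)))
    · exact max_eq_right (sub_nonpos.2 hk)

/-- Assigning the kink `k = 1` to the flat branch makes the slope right-continuous, so its right
derivative is zero everywhere. -/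
lemma hasDerivWithinAt_payoff_deriv (k : ℝ) :
    HasDerivWithinAt (fun k : ℝ => if k < 1 then (-1 : ℝ) else 0) 0 (Set.Ioi k) k := by
  by_cases hk : k < 1
  · refine (HasDerivAt.congr_of_eventuallyEq (hasDerivAt_const k (-1 : ℝ)) ?_).hasDerivWithinAt
    filter_upwards [Iio_mem_nhds hk] with y hy
    exact if_pos hy
  · refine (hasDerivWithinAt_const k _ (0 : ℝ)).congr (fun y hy => ?_) (if_neg hk)
    exact if_neg fun h => hk ((Set.mem_Ioi.1 hy).trans h)

/-- Only the slice at expiry zero lacks strict convexity. Before the first expiry the next slice has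
positive weight by `hα0`; in every later period both slices are strictly convex. -/
theorem isSmoothSurface_timeInterp [NeZero M] (hτ : StrictMono τ) (hτ0 : τ 0 = 0)
    (hα : IsTimeInterp τ α) (hα0 : ∀ t ∈ Set.Ioo 0 (τ (Fin.succ 0)), 0 < α 0 t)
    {c c' c'' : Fin M → ℝ → ℝ} (hc : ∀ j k, 0 < k → HasDerivAt (c j) (c' j k) k)
    (hc' : ∀ j k, 0 < k → HasDerivAt (c' j) (c'' j k) k) (hc'' : ∀ j k, 0 < k → 0 < c'' j k) :
    IsSmoothSurface (timeInterp τ α c) := by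
  set s' : Fin (M + 1) → ℝ → ℝ :=
    Fin.cons (α := fun _ => ℝ → ℝ) (fun k => if k < 1 then -1 else 0) c' with hs'
  set s'' : Fin (M + 1) → ℝ → ℝ := Fin.cons (α := fun _ => ℝ → ℝ) (fun _ => 0) c'' with hs''
  have h1 : ∀ i k, 0 < k → HasDerivWithinAt (slices c i) (s' i k) (Set.Ioi k) k := by
    intro i k hk
    cases i using Fin.cases with
    | zero => simpa [slices, hs'] using hasDerivWithinAt_payoff k
    | succ j => simpa [slices, hs'] using (hc j k hk).hasDerivWithinAt
  have h2 : ∀ i k, 0 < k → HasDerivWithinAt (s' i) (s'' i k) (Set.Ioi k) k := by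
    intro i k hk
    cases i using Fin.cases with
    | zero => simpa [hs'', hs'] using hasDerivWithinAt_payoff_deriv k
    | succ j => simpa [hs'', hs'] using (hc' j k hk).hasDerivWithinAt
  have h3 : ∀ i : Fin (M + 1), i ≠ 0 → ∀ k, 0 < k → 0 < s'' i k := by
    intro i hi k hk
    obtain ⟨j, rfl⟩ := Fin.exists_succ_eq.2 hi
    simpa [hs''] using hc'' j k hk
  have h4 : ∀ i k, 0 < k → 0 ≤ s'' i k := by
    intro i k hk
    by_cases hi : i = 0
    · simp [hi, hs'']
    · exact (h3 i hi k hk).le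
  intro t ht
  rcases le_or_gt (τ (Fin.last M)) t with h | h
  · refine ⟨s' (Fin.last M), s'' (Fin.last M), fun k hk => ⟨?_, h2 _ k hk,
      h3 _ (Fin.last_pos' (n := M)).ne' k hk⟩⟩
    have heq : timeInterp τ α c t = slices c (Fin.last M) := by
      ext k; rw [timeInterp, if_pos h]
    rw [heq]
    exact h1 _ k hk
  · obtain ⟨m, hm1, hm2⟩ := exists_mem_period hτ0 ht.le h
    obtain ⟨ha0, ha1⟩ := hα.mem_Icc hm1 hm2.le
    have heq : timeInterp τ α c t
        = fun k => α m t * slices c m.succ k + (1 - α m t) * slices c m.castSucc k :=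
      funext fun k => timeInterp_of_mem_period hτ c hm1 hm2 k
    refine ⟨fun k => α m t * s' m.succ k + (1 - α m t) * s' m.castSucc k,
      fun k => α m t * s'' m.succ k + (1 - α m t) * s'' m.castSucc k, fun k hk => ⟨?_, ?_, ?_⟩⟩
    · rw [heq]
      exact ((h1 _ k hk).const_mul _).add ((h1 _ k hk).const_mul _)
    · exact ((h2 _ k hk).const_mul _).add ((h2 _ k hk).const_mul _)
    · have hsucc := h3 m.succ (Fin.succ_ne_zero m) k hk
      rcases ha0.eq_or_lt with ha | ha
      · have hm : m.castSucc ≠ 0 := by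
          intro hm0
          obtain rfl : m = 0 := Fin.castSucc_eq_zero_iff.1 hm0
          exact (hα0 t ⟨ht, hm2⟩).ne ha
        rw [← ha]
        simpa using h3 _ hm k hk
      · exact add_pos_of_pos_of_nonneg (mul_pos ha hsucc)
          (mul_nonneg (sub_nonneg.2 ha1) (h4 _ k hk))

end timeInterp

/-! ### The interpolation theorem -/

lemma isMartingaleTransition_one {N : ℕ} (x : Fin N → ℝ) :
    IsMartingaleTransition x (1 : Matrix (Fin N) (Fin N) ℝ) where
  nonneg i l := by
    rw [Matrix.one_apply]
    split_ifs <;> norm_num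
  col_sum l := by simp [Matrix.one_apply]
  col_mean l := by simp [Matrix.one_apply]

/-- A martingale density with increasing variances yields the call prices of a positive discrete
martingale. -/
theorem IsMartingaleDensity.exists_martingale {M N : ℕ} [NeZero M] {x : Fin N → ℝ}
    (hx : ∀ i, 0 < x i) {q : Fin M → Fin N → ℝ} (hq : IsMartingaleDensity x q) {V : Fin M → ℝ}
    (hV : Monotone V) (hV0 : ∀ j, 0 ≤ V j) :
    ∃ (Ω : Type) (mΩ : MeasurableSpace Ω) (ρ : Measure Ω) (_ : IsProbabilityMeasure ρ)
      (𝒢 : Filtration ℕ mΩ) (Y : ℕ → Ω → ℝ), Martingale Y 𝒢 ρ ∧ (∀ n w, 0 < Y n w) ∧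
      (∀ w, Y 0 w = 1) ∧ ∀ (n : Fin (M + 1)) (k : ℝ), 0 ≤ k →
        ∫ w, max (Y n w - k) 0 ∂ρ = slices (fun j => smoothCall x (q j) (V j)) n k := by
  have hM : 0 < M := Nat.pos_of_neZero M
  -- The finite family is extended to all indices by freezing it at the last expiry, with the
  -- identity as transition from then on.
  let r : ℕ → Fin M := fun n => ⟨min n (M - 1), by omega⟩
  have hr : ∀ j : Fin M, r j = j := fun j => Fin.ext (min_eq_left (by omega))
  have hrm : Monotone r := fun a b hab => by
    change min a (M - 1) ≤ min b (M - 1)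
    exact min_le_min_right _ hab
  have hP : ∀ n, ∃ P : Matrix (Fin N) (Fin N) ℝ, IsMartingaleTransition x P ∧
      q (r (n + 1)) = P.mulVec (q (r n)) := by
    intro n
    by_cases hn : n + 1 < M
    · refine hq.transition (r n) (r (n + 1)) ?_
      change min n (M - 1) + 1 = min (n + 1) (M - 1)
      omega
    · refine ⟨1, isMartingaleTransition_one x, ?_⟩
      have : r (n + 1) = r n := Fin.ext (by change min (n + 1) (M - 1) = min n (M - 1); omega)
      rw [this, Matrix.one_mulVec]
  choose P hP hPq using hP
  obtain ⟨Ω, mΩ, ρ, hρ, 𝒢, Y, hY, hpos, hone, hprice⟩ := exists_martingale_smoothCall hx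
    (fun n => q (r n)) (fun n => hq.nonneg _) (fun n => hq.sum_one _) (hq.mean_one _) P hP hPq
    (fun n => (V (r n)).toNNReal) fun a b hab => Real.toNNReal_le_toNNReal (hV (hrm hab))
  refine ⟨Ω, mΩ, ρ, hρ, 𝒢, Y, hY, hpos, hone, fun n k hk => ?_⟩
  cases n using Fin.cases with
  | zero => simp [slices, hone]
  | succ j =>
    have h := hprice j k hk
    rw [hr, Real.coe_toNNReal _ (hV0 j)] at h
    simpa [slices] using h

/-- The densities of an arbitrage-free market form a martingale density. -/
theorem IsArbitrageFreeMarket.isMartingaleDensity {M N : ℕ} {K : Fin (N + 1) → ℝ}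
    (hK : StrictMono K) (hK0 : K 0 = 0) {C : Fin M → Fin (N + 1) → ℝ}
    (hC : IsArbitrageFreeMarket K C) :
    IsMartingaleDensity (fun i => K i.succ) fun j => marketDensity K (C j) where
  nonneg j := marketDensity_nonneg (hC.convex j)
  sum_one j := sum_marketDensity (hC.zero_unattainable j)
  mean_one j := sum_mul_marketDensity hK hK0 (hC.vanish j) (hC.unit_mean j)
  transition j j' hjj' := exists_isMartingaleTransition (marketDensity_nonneg (hC.convex j'))
    fun _ hF => sum_mul_marketDensity_le hK ((hC.unit_mean j).trans (hC.unit_mean j').symm)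
      ((hC.vanish j).trans (hC.vanish j').symm)
      ((hC.zero_unattainable j).trans (hC.zero_unattainable j').symm)
      (hC.calendar j j' (Fin.le_def.2 (by omega))) hF

/-- As the volatility vanishes, the model prices under the market densities converge to the
linearly interpolated market prices. -/
theorem IsArbitrageFreeMarket.tendstoUniformlyOn {M N : ℕ} {K : Fin (N + 1) → ℝ}
    (hK : StrictMono K) (hK0 : K 0 = 0) {C : Fin M → Fin (N + 1) → ℝ}
    (hC : IsArbitrageFreeMarket K C) (j : Fin M) {t : ℝ} (ht : 0 ≤ t) :
    TendstoUniformlyOn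
      (fun σ k => smoothCall (fun l => K l.succ) (marketDensity K (C j)) (σ ^ 2 * t) k)
      (linearInterp K (C j)) (𝓝[>] 0) (Set.Ici 0) :=
  (tendstoUniformlyOn_smoothCall (succ_strike_pos hK hK0) (marketDensity_nonneg (hC.convex j))
    (sum_mul_marketDensity hK hK0 (hC.vanish j) (hC.unit_mean j)) ht).congr_right
    fun _ hk => sum_marketDensity_mul_payoff hK hK0 (hC.vanish j) hk

theorem mainTheorem2 {M N : ℕ} [NeZero M]
    (τ : Fin (M + 1) → ℝ) (hτ : StrictMono τ) (hτ0 : τ 0 = 0)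
    (K : Fin (N + 1) → ℝ) (hK : StrictMono K) (hK0 : K 0 = 0)
    (mid ask : Fin M → Fin (N + 1) → ℝ)
    (hmid : IsArbitrageFreeMarket K mid) (hask : ∀ j i, mid j i < ask j i) :
    (∃ (q : Fin M → Fin N → ℝ) (V : Fin M → ℝ),
      IsMartingaleDensity (fun i => K i.succ) q ∧ (∀ j, 0 < V j) ∧ StrictMono V ∧
      (∀ j i, mid j i ≤ smoothCall (fun l => K l.succ) (q j) (V j) (K i) ∧
        smoothCall (fun l => K l.succ) (q j) (V j) (K i) ≤ ask j i) ∧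
      (∀ j, ContDiffOn ℝ ∞ (smoothCall (fun l => K l.succ) (q j) (V j)) (Set.Ioi 0) ∧
        ∀ k, 0 < k → 0 < iteratedDeriv 2 (smoothCall (fun l => K l.succ) (q j) (V j)) k) ∧
      ∀ α : Fin M → ℝ → ℝ, IsTimeInterp τ α →
        IsArbitrageFreeSurface
          (timeInterp τ α (fun j => smoothCall (fun l => K l.succ) (q j) (V j))) ∧
        ((∀ t ∈ Set.Ioo 0 (τ (Fin.succ 0)), 0 < α 0 t) → IsSmoothSurface
          (timeInterp τ α (fun j => smoothCall (fun l => K l.succ) (q j) (V j))))) ∧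
    ∀ j,
      (∀ k, 0 ≤ k → MonotoneOn
        (fun σ => smoothCall (fun l => K l.succ) (marketDensity K (mid j)) (σ ^ 2 * τ j.succ) k)
        (Set.Ioi 0)) ∧
      TendstoUniformlyOn
        (fun σ k =>
          smoothCall (fun l => K l.succ) (marketDensity K (mid j)) (σ ^ 2 * τ j.succ) k)
        (linearInterp K (mid j)) (𝓝[>] 0) (Set.Ici 0) := by
  have hx : ∀ i : Fin N, 0 < K i.succ := succ_strike_pos hK hK0
  have hτpos : ∀ j : Fin M, 0 < τ j.succ := succ_strike_pos hτ hτ0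
  have hp : ∀ j i, 0 ≤ marketDensity K (mid j) i := fun j =>
    marketDensity_nonneg (hmid.convex j)
  have hKnn : ∀ i, 0 ≤ K i := fun i => hK0 ▸ hK.monotone (Fin.zero_le i)
  refine ⟨?_, fun j => ⟨fun k hk σ hσ σ' _ hσσ' => ?_,
    hmid.tendstoUniformlyOn hK hK0 j (hτpos j).le⟩⟩
  · obtain ⟨σ, hσ, hσask⟩ : ∃ σ : ℝ, 0 < σ ∧ ∀ j i, smoothCall (fun l => K l.succ)
        (marketDensity K (mid j)) (σ ^ 2 * τ j.succ) (K i) < ask j i := by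
      have h : ∀ᶠ σ : ℝ in 𝓝[>] 0, ∀ j i, smoothCall (fun l => K l.succ)
          (marketDensity K (mid j)) (σ ^ 2 * τ j.succ) (K i) < ask j i := by
        refine eventually_all.2 fun j => eventually_all.2 fun i => ?_
        refine ((hmid.tendstoUniformlyOn hK hK0 j (hτpos j).le).tendsto_at
          (hKnn i)).eventually_lt_const ?_
        rw [linearInterp_node hK (hmid.vanish j)]
        exact hask j i
      exact (eventually_mem_nhdsWithin.and h).exists
    have hV : ∀ j : Fin M, 0 < σ ^ 2 * τ j.succ := fun j => mul_pos (by positivity) (hτpos j)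
    have hVm : StrictMono fun j : Fin M => σ ^ 2 * τ j.succ := fun a b hab =>
      mul_lt_mul_of_pos_left (hτ (Fin.succ_lt_succ_iff.2 hab)) (by positivity)
    have hdens := hmid.isMartingaleDensity hK hK0
    refine ⟨fun j => marketDensity K (mid j), fun j => σ ^ 2 * τ j.succ, hdens, hV, hVm,
      fun j i => ⟨?_, (hσask j i).le⟩, fun j => ⟨contDiffOn_smoothCall hx (hV j),
        fun k hk => ?_⟩, fun α hα => ⟨?_, fun hα0 => ?_⟩⟩
    -- The mid is the mean intrinsic value under the market density, so the lower bound holds for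
    -- every `σ`.
    · rw [← linearInterp_node hK (hmid.vanish j) i,
        ← sum_marketDensity_mul_payoff hK hK0 (hmid.vanish j) (hKnn i)]
      exact sum_payoff_le_smoothCall hx (hp j) (hKnn i) (hV j).le
    · rw [iteratedDeriv_two_smoothCall hx (hV j) hk]
      exact sum_mul_bsStrikeDeriv₂_pos (hp j) (hdens.sum_one j) (hV j) hk
    · obtain ⟨Ω, mΩ, ρ, hρ, 𝒢, Y, hY, hpos, hone, hprice⟩ :=
        hdens.exists_martingale hx hVm.monotone fun j => (hV j).le
      exact isArbitrageFreeSurface_timeInterp hτ hτ0 hα hY hpos hone hprice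
    · exact isSmoothSurface_timeInterp hτ hτ0 hα hα0
        (fun j k hk => hasDerivAt_smoothCall hx (hV j) hk)
        (fun j k hk => hasDerivAt_smoothCall_deriv hx hk)
        fun j k hk => sum_mul_bsStrikeDeriv₂_pos (hp j) (hdens.sum_one j) (hV j) hk
  · have hσ' : (0 : ℝ) < σ := hσ
    exact smoothCall_mono hx (hp j) hk (mul_nonneg (sq_nonneg σ) (hτpos j).le)
      (mul_le_mul_of_nonneg_right (pow_le_pow_left₀ hσ'.le hσσ' 2) (hτpos j).le)
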